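/- Let $1\le r\le n-1$, $s\ge 1$, and let $\mathbf{B}^{r,s}$ be the Kirillov–Reshetikhin crystal of type $A_{n-1}^{(1)}$, whose underlying set is the set of semistandard tableaux of rectangular shape $(s^r)$ ($r$ rows, $s$ columns) with entries in $\{1,\dots,n\}$. For $1\le i\le n-1$ the crystal operators $\widetilde e_i,\widetilde f_i$ on $\mathbf{B}^{r,s}$ are those of the word crystal, applied to the word $w_1\cdots w_{rs}$ obtained by reading the rows from top to bottom and each row from right to left, this word being identified with $w_1\otimes\cdots\otimes w_{rs}$, where $\widetilde f_i(b\otimes b')=\widetilde f_ib\otimes b'$ if $\varphi_i(b)>\varepsilon_i(b')$ and $b\otimes\widetilde f_ib'$ otherwise, and $\widetilde e_i(b\otimes b')=\widetilde e_ib\otimes b'$ if $\varphi_i(b)\ge\varepsilon_i(b')$ and $b\otimes \widetilde e_ib'$ otherwise. The weight of $T$ is $\mathrm{wt}(T)=m_1\epsilon_1+\cdots+m_n\epsilon_n$, where $m_a$ is the number of entries $a$ in $T$. Let $\mathbf{pr}$ be Schützenberger's promotion: remove all letters $n$ from $T$, slide the remaining letters by jeu de taquin into the vacated cells (taken from left to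 right), put $0$ into the cells that are then empty, and add $1$ to all entries. For $0\le k\le n-1$ let $\eta_k$ be the Lusztig (Schützenberger) involution for the Levi subalgebra with node set $J=\{1,\dots,n-1\}\setminus\{k\}$, that is, the map $\eta_k:\mathbf{B}^{r,s}\to\mathbf{B}^{r,s}$ such that (1) $\eta_k^2=\mathrm{id}$; (2) $\mathrm{wt}(\eta_k(T))=w_0^J(\mathrm{wt}(T))$, where $w_0^J$ is the longest element of the Weyl group of $J$: it sends $\epsilon_a$ to $\epsilon_{k+1-a}$ for $a\le k$ and to $\epsilon_{n+k+1-a}$ for $a>k$; (3) $\eta_k(\widetilde e_iT)=\widetilde f_{i^*}\eta_k(T)$ and $\eta_k(\widetilde f_iT)=\widetilde e_{i^*}\eta_k(T)$ for $i\in J$, where $i^*=k-i$ if $i<k$ and $i^*=n+k-i$ if $i>k$ (with $\eta_k(\mathbf 0)=\mathbf 0$). Then, for every $1\le k\le n-1$, there is exactly one map $\eta_0$ and exactly one map $\eta_k$ on $\mathbf{B}^{r,s}$ with these properties, and $$\mathbf{pr}^k=\eta_k\circ\eta_0\quad\text{on } \mathbf{B}^{r,s}.$$ -/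

import Mathlib

namespace KRCrystal

/-- The rectangular Young diagram `(s^r)` with `r` rows and `s` columns (cells are indexed from
`0`, as in Mathlib). -/
def rect (r s : ℕ) : YoungDiagram where
  cells := Finset.range r ×ˢ Finset.range s
  isLowerSet := by
    rintro ⟨i, j⟩ ⟨i', j'⟩ h hij
    simp only [Finset.coe_product, Finset.coe_range, Set.mem_prod, Set.mem_Iio] at hij ⊢
    exact ⟨lt_of_le_of_lt h.1 hij.1, lt_of_le_of_lt h.2 hij.2⟩

/-- `SST n r s`: the semistandard tableaux of rectangular shape `(s^r)` with entries in
`[n] = {1, …, n}`.  This is the underlying set of the Kirillov-Reshetikhin crystal `B^{r,s}` of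
type `A_{n-1}^{(1)}`. -/
def SST (n r s : ℕ) : Type :=
  {T : SemistandardYoungTableau (rect r s) // ∀ i j, (i, j) ∈ rect r s → 1 ≤ T i j ∧ T i j ≤ n}

namespace SST

variable {n r s : ℕ}

/-- The entries of a tableau, as a function of the row and the column (`0` outside the shape). -/
def fill (T : SST n r s) : ℕ → ℕ → ℕ := T.1.entry

/-- The reading word of a tableau: rows from top to bottom, each row from right to left. -/
def word (T : SST n r s) : List ℕ :=
  (List.range r).flatMap fun i => (List.range s).reverse.map fun j => T.fill i j

/-- The multiplicity `m_a` of the letter `a`, so that `wt T = m_1 ε_1 + ⋯ + m_n ε_n`.  (All tableaux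
of shape `(s^r)` have the same total `m_1 + ⋯ + m_n = r s`, so that comparing weights modulo
`ε_1 + ⋯ + ε_n = 0` is the same as comparing all multiplicities.) -/
def mult (T : SST n r s) (a : ℕ) : ℕ := T.word.count a

end SST

/-! ### The crystal of words

A word `w₁ ⋯ w_l` is identified with `w₁ ⊗ ⋯ ⊗ w_l` in the tensor power of the crystal
`1 → 2 → ⋯ → n` of the natural representation.  The formal symbol `0` is `none`. -/

/-- `ε_i` of a letter. -/
def letterEps (i a : ℕ) : ℕ := if a = i + 1 then 1 else 0

/-- `φ_i` of a letter. -/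
def letterPhi (i a : ℕ) : ℕ := if a = i then 1 else 0

/-- `ε_i` of a word, through
`ε_i(b ⊗ w) = max (ε_i b) (ε_i w - ⟨wt b, h_i⟩) = ε_i b + max 0 (ε_i w - φ_i b)`. -/
def wordEps (i : ℕ) : List ℕ → ℕ
  | [] => 0
  | a :: w => letterEps i a + (wordEps i w - letterPhi i a)

/-- `ẽ_i` on words: `ẽ_i (b ⊗ w) = ẽ_i b ⊗ w` if `φ_i b ≥ ε_i w`, and `b ⊗ ẽ_i w` otherwise. -/
def wordE (i : ℕ) : List ℕ → Option (List ℕ)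
  | [] => none
  | a :: w =>
      if letterPhi i a ≥ wordEps i w then (if a = i + 1 then some (i :: w) else none)
      else (wordE i w).map (fun w' => a :: w')

/-- `f̃_i` on words: `f̃_i (b ⊗ w) = f̃_i b ⊗ w` if `φ_i b > ε_i w`, and `b ⊗ f̃_i w` otherwise. -/
def wordF (i : ℕ) : List ℕ → Option (List ℕ)
  | [] => none
  | a :: w =>
      if letterPhi i a > wordEps i w then (if a = i then some ((i + 1) :: w) else none)
      else (wordF i w).map (fun w' => a :: w')

namespace SST

variable {n r s : ℕ}

open Classical in
/-- The operator `ẽ_i` (`1 ≤ i ≤ n - 1`) on tableaux: tableaux form a subcrystal of the crystal of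
words, via the reading word. -/
noncomputable def e (i : ℕ) (T : SST n r s) : Option (SST n r s) :=
  if h : ∃ T' : SST n r s, wordE i T.word = some T'.word then some h.choose else none

open Classical in
/-- The operator `f̃_i` (`1 ≤ i ≤ n - 1`) on tableaux. -/
noncomputable def f (i : ℕ) (T : SST n r s) : Option (SST n r s) :=
  if h : ∃ T' : SST n r s, wordF i T.word = some T'.word then some h.choose else none

end SST

/-! ### The Lusztig involution of a Levi subalgebra

For `0 ≤ k ≤ n - 1` the Levi subalgebra has the nodes `I_{0,k} = {1, …, n - 1} \ {k}`. -/

/-- The action on `{1, …, n}` of the longest element of the Weyl group `S_k × S_{n-k}` of the Levi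
subalgebra with nodes `{1, …, n - 1} \ {k}`. -/
def longest (n k a : ℕ) : ℕ := if a ≤ k then k + 1 - a else n + k + 1 - a

/-- The diagram automorphism `i ↦ i*` of `{1, …, n - 1} \ {k}` with `w₀ (α_i) = -α_{i*}`. -/
def star (n k i : ℕ) : ℕ := if i < k then k - i else n + k - i

/-- The defining properties of the Lusztig involution on the set of tableaux, as a crystal of the
Levi subalgebra with nodes `{1, …, n - 1} \ {k}`. -/
structure IsLusztigInvolution {n r s : ℕ} (k : ℕ) (η : SST n r s → SST n r s) : Prop where
  involutive : ∀ T, η (η T) = T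
  wt : ∀ T, ∀ a, 1 ≤ a → a ≤ n → (η T).mult (longest n k a) = T.mult a
  map_e : ∀ T, ∀ i, 1 ≤ i → i < n → i ≠ k → (T.e i).map η = (η T).f (star n k i)
  map_f : ∀ T, ∀ i, 1 ≤ i → i < n → i ≠ k → (T.f i).map η = (η T).e (star n k i)

/-- The Lusztig involution `η_k`. -/
noncomputable def lusztig {n r s : ℕ} (k : ℕ) : SST n r s → SST n r s :=
  haveI : Nonempty (SST n r s → SST n r s) := ⟨id⟩
  Classical.epsilon (IsLusztigInvolution k)

/-! ### Schützenberger's promotion -/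

/-- The entry above the cell `(i, j)`, or `0` in the top row. -/
def above (S : ℕ → ℕ → ℕ) (i j : ℕ) : ℕ := if i = 0 then 0 else S (i - 1) j

/-- The entry to the left of the cell `(i, j)`, or `0` in the first column. -/
def leftOf (S : ℕ → ℕ → ℕ) (i j : ℕ) : ℕ := if j = 0 then 0 else S i (j - 1)

/-- The filling `S` with the entry of the cell `(i, j)` replaced by `x`. -/
def setCell (S : ℕ → ℕ → ℕ) (i j x : ℕ) : ℕ → ℕ → ℕ :=
  fun i' j' => if i' = i ∧ j' = j then x else S i' j'

/-- The jeu de taquin slide of `S` into the hole `(i, j)`: the larger of the entries above and to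
the left of the hole, the one above if they are equal, moves into the hole, and so on.  An entry `0`
marks an empty cell; the cell where the hole stops is given the entry `0`. -/
def slide (S : ℕ → ℕ → ℕ) (i j : ℕ) : ℕ → ℕ → ℕ :=
  if h : above S i j = 0 ∧ leftOf S i j = 0 then setCell S i j 0
  else if leftOf S i j ≤ above S i j then slide (setCell S i j (above S i j)) (i - 1) j
  else slide (setCell S i j (leftOf S i j)) i (j - 1)
termination_by i + j
decreasing_by
  · have : i ≠ 0 := by
      rintro rfl
      simp_all [above]
    omega
  · have : j ≠ 0 := by
      rintro rfl
      simp_all [leftOf]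
    omega

/-- Schützenberger's promotion on fillings of the rectangle `(s^r)` by `1, …, n`: the letters `n`,
which in a semistandard tableau lie in the bottom row, are removed, the other letters slide into
the vacated cells, taken from left to right, the cells that are then empty are filled with `0`, and
finally all letters are increased by `1`. -/
def promotion (n r s : ℕ) (T : ℕ → ℕ → ℕ) : ℕ → ℕ → ℕ :=
  let S := (List.range s).foldl
    (fun S j => if T (r - 1) j = n then slide S (r - 1) j else S) T
  fun i j => if i < r ∧ j < s then S i j + 1 else 0

end KRCrystal

/-!
A tableau is encoded by its array: the numbers `M x a` of letters `a` in row `x`. On arrays there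
are two families of crystal operators, given by the same bracket rule: the letter operators `f̃_i`
(`LetterStep`), which change a letter `i` of some row into `i + 1`, and the row operators
(`RowStep`), which move some letter from row `t` to row `t + 1`. The two families commute
(`LetterStep.rowStep`); this only has to be checked on the block of two rows and two letters that
is affected by both.

*Promotion.* A slide of jeu de taquin moves entries down out of the way of a hole, and each such
move is a row operator (`rowStep_of_hole`, `slide_spec`). Hence, apart from the letters `n` that
are removed and the letters `1` that are added, promotion is a composite of row operators, and it
intertwines `f̃_i` with `f̃_{i+1}` for `1 ≤ i ≤ n - 2` (`FStep.pr`).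

*Multiplicity-freeness.* A tableau of rectangular shape to which no `ẽ_i` with `i < k - 1` and no
`f̃_i` with `i > k` applies is determined by its weight: in row `x` (counted from `0`) only the
letter `x + 1` among those less than `k`, and only the largest possible letter among those greater
than `k`, can occur, and the letters `k` fill up the rows (`eq_of_extremal`). Consequently two
tableaux are equal as soon as they cannot be distinguished by weights and these operators
(`eq_of_bisimulation`). This gives the injectivity of promotion, the relation `pr² f̃_{n-1} = f̃_1
pr²` (`FStep.pr_pr`, `fStep_pr_pr_iff`), and the uniqueness of the Lusztig involutions
(`IsTwist.unique`).

*The involutions.* For a rectangle, `η_0` is the rotation by 180 degrees combined with the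
complement `a ↦ n + 1 - a`, which reverses and complements the reading word. By the intertwining
properties of promotion, `pr^k ∘ η_0` has the properties that characterize `η_k`, apart from being
an involution; but its inverse has these properties as well, so that both coincide by uniqueness
(`isLusztigInvolution_iterate_pr_rot`). As `η_0` is an involution, `pr^k = η_k ∘ η_0` follows.
-/

namespace KRCrystal

/-! ### Arrays and their crystal operators -/

/-- The height function of the bracket sequence `)^{q 0} (^{p 0} )^{q 1} (^{p 1} ⋯`, measured after
the closing brackets of block `x`, where an opening bracket counts `1` and a closing one `-1`. -/
def height (p q : ℕ → ℕ) (x : ℕ) : ℤ :=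
  ∑ y ∈ Finset.range x, (p y : ℤ) - ∑ y ∈ Finset.range (x + 1), (q y : ℤ)

/-- `x` is the last place where `h` attains its minimum.  For the height of a bracket sequence, this
is the block of the leftmost unmatched opening bracket, on which `f̃` acts. -/
def IsLastMin (h : ℕ → ℤ) (x : ℕ) : Prop := (∀ y < x, h x ≤ h y) ∧ ∀ y, x < y → h x < h y

theorem IsLastMin.unique {h : ℕ → ℤ} {x y : ℕ} (hx : IsLastMin h x) (hy : IsLastMin h y) :
    x = y := by
  rcases lt_trichotomy x y with hlt | rfl | hlt
  · have := hx.2 y hlt; have := hy.1 x hlt; omega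
  · rfl
  · have := hy.2 x hlt; have := hx.1 y hlt; omega

/-- The operator `f̃_i` on arrays `M`, where `M x a` is the number of letters `a` in row `x`: a
letter `i` is replaced by `i + 1` in the row given by the bracket rule. -/
def LetterStep (i : ℕ) (M N : ℕ → ℕ → ℕ) : Prop :=
  ∃ x, IsLastMin (height (fun y => M y i) (fun y => M y (i + 1))) x ∧
    ∀ y a, (N y a : ℤ) + (if y = x ∧ a = i then 1 else 0) =
      M y a + (if y = x ∧ a = i + 1 then 1 else 0)

/-- The operator `f̃_t` of the dual crystal structure on arrays, with rows and letters exchanged: a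
letter is moved from row `t` to row `t + 1`. -/
def RowStep (t : ℕ) (M N : ℕ → ℕ → ℕ) : Prop :=
  LetterStep t (Function.swap M) (Function.swap N)

theorem height_succ_sub (p q : ℕ → ℕ) (x : ℕ) :
    height p q (x + 1) - height p q x = (p x : ℤ) - q (x + 1) := by
  simp only [height, Finset.sum_range_succ]; ring

theorem height_congr {p q p' q' : ℕ → ℕ} (hp : ∀ y, p y = p' y) (hq : ∀ y, q y = q' y) :
    height p q = height p' q' := by
  rw [funext hp, funext hq]

/-- The change of the height functions in the row direction under a letter step. -/
theorem height_row_of_move {M N : ℕ → ℕ → ℕ} {i x : ℕ}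
    (hN : ∀ y a, (N y a : ℤ) + (if y = x ∧ a = i then 1 else 0) =
      M y a + (if y = x ∧ a = i + 1 then 1 else 0)) (t b : ℕ) :
    height (N t) (N (t + 1)) b = height (M t) (M (t + 1)) b
      - (if x = t ∧ b = i + 1 then 1 else 0) + (if x = t + 1 ∧ b = i then 1 else 0) := by
  have key : ∀ y c, ∑ a ∈ Finset.range c, (N y a : ℤ) =
      ∑ a ∈ Finset.range c, (M y a : ℤ) - (if x = y ∧ c = i + 1 then 1 else 0) := by
    intro y c
    induction c with
    | zero => simp
    | succ c ih =>
      have := hN y c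
      rw [Finset.sum_range_succ, Finset.sum_range_succ, ih]
      split_ifs at this ⊢ <;> omega
  simp only [height, key]
  split_ifs <;> omega

/-- The change of the height function of a letter step under this step. -/
theorem height_letter_of_move {M N : ℕ → ℕ → ℕ} {i x : ℕ}
    (hN : ∀ y a, (N y a : ℤ) + (if y = x ∧ a = i then 1 else 0) =
      M y a + (if y = x ∧ a = i + 1 then 1 else 0)) (z : ℕ) :
    height (fun y => N y i) (fun y => N y (i + 1)) z =
      height (fun y => M y i) (fun y => M y (i + 1)) z
      - (if x = z then 1 else 0) - (if x < z then 2 else 0) := by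
  have k1 : ∀ c, ∑ a ∈ Finset.range c, (N a i : ℤ) =
      ∑ a ∈ Finset.range c, (M a i : ℤ) - (if x < c then 1 else 0) := by
    intro c
    induction c with
    | zero => simp
    | succ c ih =>
      have := hN c i
      rw [Finset.sum_range_succ, Finset.sum_range_succ, ih]
      split_ifs at this ⊢ <;> omega
  have k2 : ∀ c, ∑ a ∈ Finset.range c, (N a (i + 1) : ℤ) =
      ∑ a ∈ Finset.range c, (M a (i + 1) : ℤ) + (if x < c then 1 else 0) := by
    intro c
    induction c with
    | zero => simp
    | succ c ih =>
      have := hN c (i + 1)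
      rw [Finset.sum_range_succ, Finset.sum_range_succ, ih]
      split_ifs at this ⊢ <;> omega
  simp only [height, k1, k2]
  split_ifs <;> omega

/-- A step is determined by its source. -/
theorem LetterStep.unique {i : ℕ} {M N N' : ℕ → ℕ → ℕ} (h : LetterStep i M N)
    (h' : LetterStep i M N') : N = N' := by
  obtain ⟨x, hx, hN⟩ := h
  obtain ⟨x', hx', hN'⟩ := h'
  obtain rfl := hx.unique hx'
  funext y a
  have := hN y a; have := hN' y a
  omega

/-- A step is determined by its target: the row on which it acted is the first minimum of the height
function of the target. -/
theorem LetterStep.unique_left {i : ℕ} {M M' N : ℕ → ℕ → ℕ} (h : LetterStep i M N)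
    (h' : LetterStep i M' N) : M = M' := by
  obtain ⟨x, hx, hN⟩ := h
  obtain ⟨x', hx', hN'⟩ := h'
  have e : ∀ z, _ := fun z =>
    (height_letter_of_move hN z).symm.trans (height_letter_of_move hN' z)
  obtain rfl : x = x' := by
    have e1 := e x; have e2 := e x'
    rcases lt_trichotomy x x' with hlt | rfl | hlt
    · have h1 := hx.2 x' hlt; have h2 := hx'.1 x hlt
      split_ifs at e1 e2 <;> omega
    · rfl
    · have h1 := hx'.2 x hlt; have h2 := hx.1 x' hlt
      split_ifs at e1 e2 <;> omega
  funext y a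
  have := hN y a; have := hN' y a
  omega

/-- The two height functions have the same increment across the block of rows `t, t + 1` and
letters `i, i + 1`. -/
theorem height_cross (M : ℕ → ℕ → ℕ) (t i : ℕ) :
    height (fun y => M y i) (fun y => M y (i + 1)) (t + 1) -
      height (fun y => M y i) (fun y => M y (i + 1)) t =
    height (M t) (M (t + 1)) (i + 1) - height (M t) (M (t + 1)) i := by
  rw [height_succ_sub, height_succ_sub]

section Perturb

variable {h h' : ℕ → ℤ} {i x : ℕ} {P Q : Prop} [Decidable P] [Decidable Q]

/-- Lowering `h` by one at the top of an ascent, or raising it by one at the top of a weak descent,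
does not change the last minimum, unless a last minimum at the bottom of the ascent is met. -/
theorem IsLastMin.perturb (hx : IsLastMin h x) (hP : P → h i < h (i + 1))
    (hQ : Q → h (i + 1) ≤ h i)
    (e : ∀ y, h' y = h y - (if P ∧ y = i + 1 then 1 else 0) + (if Q ∧ y = i then 1 else 0))
    (hs : ¬(x = i ∧ P ∧ h (i + 1) = h i + 1)) : IsLastMin h' x := by
  have hg : ∀ u v, u = v → h u = h v := fun u v h => h ▸ rfl
  have e1 := e x
  have h4 : i < x → h x ≤ h i := fun hi => hx.1 _ hi
  have h5 : x < i → h x < h i := fun hi => hx.2 _ hi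
  have h6 : x < i + 1 → h x < h (i + 1) := fun hi => hx.2 _ hi
  have x1 := hg x i
  have x2 := hg x (i + 1)
  refine ⟨fun y hy => ?_, fun y hy => ?_⟩
  · have h1 := hx.1 y hy
    have e2 := e y
    have y1 := hg y i
    have y2 := hg y (i + 1)
    by_cases p : P <;> by_cases q : Q <;> simp only [p, q, true_and, false_and, if_false,
      forall_const] at hP hQ e1 e2 hs <;> (try split_ifs at e1 e2) <;> omega
  · have h1 := hx.2 y hy
    have e2 := e y
    have y1 := hg y i
    have y2 := hg y (i + 1)
    by_cases p : P <;> by_cases q : Q <;> simp only [p, q, true_and, false_and, if_false,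
      forall_const] at hP hQ e1 e2 hs <;> (try split_ifs at e1 e2) <;> omega

theorem IsLastMin.perturb_succ (hx : IsLastMin h i) (hs : h (i + 1) = h i + 1)
    (e : ∀ y, h' y = h y - (if y = i + 1 then 1 else 0)) : IsLastMin h' (i + 1) := by
  have e1 := e (i + 1)
  refine ⟨fun y hy => ?_, fun y hy => ?_⟩
  · have h1 : h i ≤ h y := by
      rcases Nat.lt_succ_iff_lt_or_eq.1 hy with h | rfl
      · exact hx.1 _ h
      · exact le_rfl
    have e2 := e y
    split_ifs at e1 e2 <;> omega
  · have h1 := hx.2 y (by omega)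
    have e2 := e y
    split_ifs at e1 e2 <;> omega

theorem IsLastMin.exists_of_perturb (hx : IsLastMin h' x) (hP : P → h i < h (i + 1))
    (hQ : Q → h (i + 1) ≤ h i)
    (e : ∀ y, h' y = h y - (if P ∧ y = i + 1 then 1 else 0) + (if Q ∧ y = i then 1 else 0)) :
    ∃ x, IsLastMin h x := by
  have hg : ∀ u v, u = v → h u = h v ∧ h' u = h' v := fun u v h => h ▸ ⟨rfl, rfl⟩
  have e3 := e i
  have e4 := e (i + 1)
  by_cases hs : x = i + 1 ∧ P
  · obtain ⟨rfl, p⟩ := hs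
    have h0 := hx.1 i (by omega)
    have hP := hP p
    have hQ' : ¬Q := fun q => by have := hQ q; omega
    simp only [p, hQ', true_and, false_and, if_false] at e e3 e4
    refine ⟨i, fun y hy => ?_, fun y hy => ?_⟩
    · have h1 := hx.1 y (by omega)
      have h2 := e y
      split_ifs at e3 e4 h2 <;> omega
    · have h2 := e y
      rcases (show y = i + 1 ∨ i + 1 < y by omega) with rfl | h
      · split_ifs at e3 e4 h2 <;> omega
      · have h1 := hx.2 y h
        split_ifs at e3 e4 h2 <;> omega
  · have h4 : i < x → h' x ≤ h' i := fun hi => hx.1 _ hi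
    have h5 : x < i → h' x < h' i := fun hi => hx.2 _ hi
    have h6 : i + 1 < x → h' x ≤ h' (i + 1) := fun hi => hx.1 _ hi
    have h7 : x < i + 1 → h' x < h' (i + 1) := fun hi => hx.2 _ hi
    have x1 := hg x i
    have x2 := hg x (i + 1)
    have e1 := e x
    refine ⟨x, fun y hy => ?_, fun y hy => ?_⟩
    · have h1 := hx.1 y hy
      have e2 := e y
      have y1 := hg y i
      have y2 := hg y (i + 1)
      by_cases p : P <;> by_cases q : Q <;> simp only [p, q, true_and, false_and, if_false,
        and_true, and_false, forall_const] at hP hQ e1 e2 e3 e4 hs <;>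
        (try split_ifs at e1 e2 e3 e4) <;> omega
    · have h1 := hx.2 y hy
      have e2 := e y
      have y1 := hg y i
      have y2 := hg y (i + 1)
      by_cases p : P <;> by_cases q : Q <;> simp only [p, q, true_and, false_and, if_false,
        and_true, and_false, forall_const] at hP hQ e1 e2 e3 e4 hs <;>
        (try split_ifs at e1 e2 e3 e4) <;> omega

end Perturb

/-- Letter operators commute with row operators. -/
theorem LetterStep.rowStep {i t : ℕ} {M N M' N' : ℕ → ℕ → ℕ} (h : LetterStep i M N)
    (hM : RowStep t M M') (hN : RowStep t N N') : LetterStep i M' N' := by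
  obtain ⟨x, hx, hMN⟩ := h
  obtain ⟨a, ha, hMM⟩ := hM
  obtain ⟨a', ha', hNN⟩ := hN
  have hD := height_row_of_move hMM i
  have hC := height_row_of_move hMN t
  have hcr := height_cross M t i
  simp only [Function.swap] at hMM hNN
  change IsLastMin (height (M t) (M (t + 1))) a at ha
  change IsLastMin (height (N t) (N (t + 1))) a' at ha'
  change ∀ b, height (fun y => M' y i) (fun y => M' y (i + 1)) b =
    height (fun y => M y i) (fun y => M y (i + 1)) b - _ + _ at hD
  unfold LetterStep
  set D' := height (fun y => M' y i) (fun y => M' y (i + 1))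
  set D := height (fun y => M y i) (fun y => M y (i + 1))
  set C := height (M t) (M (t + 1))
  set C' := height (N t) (N (t + 1))
  have xt : x = t → C i < C (i + 1) := by
    rintro rfl; have := hx.2 (x + 1) (by omega); omega
  have xt' : x = t + 1 → C (i + 1) ≤ C i := by
    rintro rfl; have := hx.1 t (by omega); omega
  have ai : a = i → D t < D (t + 1) := by
    rintro rfl; have := ha.2 (a + 1) (by omega); omega
  have ai' : a = i + 1 → D (t + 1) ≤ D t := by
    rintro rfl; have := ha.1 i (by omega); omega
  by_cases hs : x = t ∧ a = i ∧ D (t + 1) = D t + 1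
  · -- Both operators act on the same letter: after either one, the other acts on the other
    -- corner of the block.
    obtain ⟨rfl, rfl, hs⟩ := hs
    obtain rfl : a' = a + 1 := ha'.unique (ha.perturb_succ (by omega) (by simpa using hC))
    refine ⟨x + 1, hx.perturb_succ (by omega) (by simpa using hD), fun y b => ?_⟩
    have h1 := hMN y b
    have h2 := hMM b y
    have h3 := hNN b y
    split_ifs at h1 h2 h3 ⊢ <;> omega
  · obtain rfl : a' = a := ha'.unique (ha.perturb xt xt' hC (by omega))
    refine ⟨x, hx.perturb ai ai' hD (by omega), fun y b => ?_⟩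
    have h1 := hMN y b
    have h2 := hMM b y
    have h3 := hNN b y
    split_ifs at h1 h2 h3 ⊢ <;> omega

/-- If `f̃_i` is defined after a row operator, it was defined before. -/
theorem RowStep.exists_isLastMin {i t : ℕ} {M M' : ℕ → ℕ → ℕ} (hM : RowStep t M M') {x : ℕ}
    (hx : IsLastMin (height (fun y => M' y i) (fun y => M' y (i + 1))) x) :
    ∃ x, IsLastMin (height (fun y => M y i) (fun y => M y (i + 1))) x := by
  obtain ⟨a, ha, hMM⟩ := hM
  have hD := height_row_of_move hMM i
  have hcr := height_cross M t i
  change IsLastMin (height (M t) (M (t + 1))) a at ha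
  refine hx.exists_of_perturb (i := t) (P := a = i) (Q := a = i + 1) ?_ ?_ hD
  · rintro rfl; have := ha.2 (a + 1) (by omega); omega
  · rintro rfl; have := ha.1 i (by omega); omega

/-! ### Crystal operators on words that are concatenations of rows -/

theorem wordF_eq_some {i : ℕ} : ∀ {w w' : List ℕ}, wordF i w = some w' →
    wordEps i w' = wordEps i w + 1 ∧ wordE i w' = some w
  | [], _, h => by simp [wordF] at h
  | a :: w, w', h => by
    rw [wordF] at h
    split_ifs at h with h1 h2
    · obtain rfl := Option.some.inj h
      subst h2
      simp only [letterPhi, if_true] at h1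
      have : wordEps a w = 0 := by omega
      simp [wordEps, wordE, letterEps, letterPhi, this]
    · obtain ⟨v, hv, rfl⟩ := Option.map_eq_some_iff.1 h
      obtain ⟨e1, e2⟩ := wordF_eq_some hv
      refine ⟨?_, ?_⟩
      · simp only [wordEps]; omega
      · rw [wordE, if_neg (by omega), e2]; rfl

theorem wordE_eq_some {i : ℕ} : ∀ {w w' : List ℕ}, wordE i w = some w' →
    wordEps i w = wordEps i w' + 1 ∧ wordF i w' = some w
  | [], _, h => by simp [wordE] at h
  | a :: w, w', h => by
    rw [wordE] at h
    split_ifs at h with h1 h2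
    · obtain rfl := Option.some.inj h
      subst h2
      have h0 : wordEps i w = 0 := by simpa [letterPhi] using h1
      simp [wordEps, wordF, letterEps, letterPhi, h0]
    · obtain ⟨v, hv, rfl⟩ := Option.map_eq_some_iff.1 h
      obtain ⟨e1, e2⟩ := wordE_eq_some hv
      refine ⟨?_, ?_⟩
      · simp only [wordEps]; omega
      · rw [wordF, if_neg (by omega), e2]; rfl

theorem wordE_eq_some_iff {i : ℕ} {w w' : List ℕ} :
    wordE i w = some w' ↔ wordF i w' = some w :=
  ⟨fun h => (wordE_eq_some h).2, fun h => (wordF_eq_some h).2⟩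

/-- In a weakly decreasing row all letters `i + 1` precede all letters `i`, so that no brackets of
the row are matched with each other. -/
theorem wordEps_append {i : ℕ} {w : List ℕ} : ∀ {l : List ℕ}, l.Pairwise (· ≥ ·) →
    wordEps i (l ++ w) = l.count (i + 1) + (wordEps i w - l.count i)
  | [], _ => by simp
  | a :: l, h => by
    rw [List.pairwise_cons] at h
    have ih := wordEps_append (i := i) (w := w) h.2
    simp only [List.cons_append, wordEps, ih, letterEps, letterPhi, List.count_cons, beq_iff_eq]
    by_cases ha : a = i
    · have : l.count (i + 1) = 0 := List.count_eq_zero.2 fun hm => by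
        have := h.1 _ hm; omega
      subst ha
      simp only [this, if_true]
      split_ifs <;> omega
    · simp only [ha, if_false]
      split_ifs <;> omega

theorem wordF_append_of_lt {i : ℕ} {w : List ℕ} : ∀ {l : List ℕ}, l.Pairwise (· ≥ ·) →
    wordEps i w < l.count i →
    ∃ l' : List ℕ, l'.Pairwise (· ≥ ·) ∧
      (∀ a, l'.count a + (if a = i then 1 else 0) = l.count a + (if a = i + 1 then 1 else 0)) ∧
      wordF i (l ++ w) = some (l' ++ w)
  | [], _, h => by simp at h
  | a :: l, hl, h => by
    rw [List.pairwise_cons] at hl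
    have he := wordEps_append (i := i) (w := w) hl.2
    by_cases ha : a = i
    · subst ha
      have : l.count (a + 1) = 0 := List.count_eq_zero.2 fun hm => by
        have := hl.1 _ hm; omega
      rw [List.count_cons_self] at h
      refine ⟨(a + 1) :: l, List.pairwise_cons.2 ⟨fun b hb => (hl.1 b hb).trans (by omega), hl.2⟩,
        fun b => ?_, ?_⟩
      · simp only [List.count_cons, beq_iff_eq]
        split_ifs <;> omega
      · simp only [List.cons_append, wordF, letterPhi, if_true]
        rw [if_pos (by omega)]
    · rw [List.count_cons_of_ne ha] at h
      obtain ⟨l', h1, h2, h3⟩ := wordF_append_of_lt hl.2 h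
      have hi : i < a := by
        have := hl.1 i (List.count_pos_iff.1 (by omega)); omega
      refine ⟨a :: l', List.pairwise_cons.2 ⟨fun b hb => ?_, h1⟩, fun b => ?_, ?_⟩
      · have hb' := h2 b
        have := List.count_pos_iff.2 hb
        by_cases hbi : b = i + 1
        · omega
        · rw [if_neg hbi] at hb'
          exact hl.1 b (List.count_pos_iff.1 (by omega))
      · have := h2 b
        simp only [List.count_cons]; omega
      · simp only [List.cons_append, wordF, letterPhi, ha, if_false]
        rw [if_neg (by omega), h3]; rfl

theorem wordF_append_of_le {i : ℕ} {w : List ℕ} : ∀ {l : List ℕ}, l.Pairwise (· ≥ ·) →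
    l.count i ≤ wordEps i w →
    wordF i (l ++ w) = (wordF i w).map (l ++ ·)
  | [], _, _ => by simp
  | a :: l, hl, h => by
    rw [List.pairwise_cons] at hl
    have he := wordEps_append (i := i) (w := w) hl.2
    have h' : l.count i ≤ wordEps i w := le_trans List.count_le_count_cons h
    have ih := wordF_append_of_le hl.2 h'
    have hc : ¬ letterPhi i a > wordEps i (l ++ w) := by
      by_cases ha : a = i
      · subst ha
        rw [List.count_cons_self] at h
        simp only [letterPhi, if_true]; omega
      · simp [letterPhi, ha]
    simp only [List.cons_append, wordF]
    rw [if_neg hc, ih, Option.map_map]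
    rfl

theorem height_succ (p q : ℕ → ℕ) (x : ℕ) :
    height p q (x + 1) = p 0 - q 0 + height (fun y => p (y + 1)) (fun y => q (y + 1)) x := by
  simp only [height, Finset.sum_range_succ' _ x, Finset.sum_range_succ' _ (x + 1)]; ring

theorem height_zero (p q : ℕ → ℕ) : height p q 0 = -(q 0 : ℤ) := by simp [height]

/-- The word with rows `L 0, …, L (r - 1)`. -/
def rowsWord (r : ℕ) (L : ℕ → List ℕ) : List ℕ := (List.range r).flatMap L

theorem rowsWord_succ (r : ℕ) (L : ℕ → List ℕ) :
    rowsWord (r + 1) L = L 0 ++ rowsWord r (fun x => L (x + 1)) := by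
  simp [rowsWord, List.range_succ_eq_map, List.flatMap_map]

/-- The height function of the `i`-brackets of a sequence of rows. -/
def rowsHeight (i : ℕ) (L : ℕ → List ℕ) : ℕ → ℤ :=
  height (fun x => (L x).count i) (fun x => (L x).count (i + 1))

theorem wordEps_rowsWord_le {i : ℕ} : ∀ {r : ℕ} {L : ℕ → List ℕ}, (∀ x, (L x).Pairwise (· ≥ ·)) →
    (∀ x, r ≤ x → L x = []) → ∀ c : ℕ,
    (wordEps i (rowsWord r L) ≤ c ↔ ∀ z, -rowsHeight i L z ≤ c)
  | 0, L, _, h0, c => by simp [rowsWord, wordEps, rowsHeight, height, h0]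
  | r + 1, L, hL, h0, c => by
    have ih := wordEps_rowsWord_le (i := i) (r := r) (L := fun x => L (x + 1)) (fun x => hL _)
      (fun x hx => h0 _ (by omega))
    rw [rowsWord_succ, wordEps_append (hL 0)]
    constructor
    · rintro h (_ | z)
      · rw [rowsHeight, height_zero]; omega
      · have := (ih (c + (L 0).count i - (L 0).count (i + 1))).1 (by omega) z
        rw [rowsHeight, height_succ]
        rw [rowsHeight] at this
        omega
    · intro h
      have h1 := h 0
      rw [rowsHeight, height_zero] at h1
      have := (ih (c + (L 0).count i - (L 0).count (i + 1))).2 fun z => by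
        have := h (z + 1)
        rw [rowsHeight, height_succ] at this
        rw [rowsHeight]
        omega
      omega

/-- `f̃_i` acts on the row where the height function attains its minimum for the last time. -/
theorem wordF_rowsWord_of_isLastMin {i : ℕ} : ∀ {r : ℕ} {L : ℕ → List ℕ},
    (∀ x, (L x).Pairwise (· ≥ ·)) → (∀ x, r ≤ x → L x = []) →
    ∀ {x : ℕ}, IsLastMin (rowsHeight i L) x → ∃ l' : List ℕ, l'.Pairwise (· ≥ ·) ∧
      (∀ a, l'.count a + (if a = i then 1 else 0) = (L x).count a + (if a = i + 1 then 1 else 0)) ∧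
      wordF i (rowsWord r L) = some (rowsWord r (Function.update L x l'))
  | 0, L, _, h0, x, hx => by
    have := hx.2 (x + 1) (by omega)
    simp [rowsHeight, height, h0] at this
  | r + 1, L, hL, h0, 0, hx => by
    have he := wordEps_rowsWord_le (i := i) (r := r) (L := fun x => L (x + 1)) (fun x => hL _)
      (fun x hx => h0 _ (by omega))
    have hp : 0 < (L 0).count i := by
      have := hx.2 1 (by omega)
      have h2 := height_succ_sub (fun x => (L x).count i) (fun x => (L x).count (i + 1)) 0
      rw [rowsHeight] at this
      rw [zero_add] at h2
      omega
    have h1 := (he ((L 0).count i - 1)).2 fun z => by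
      have := hx.2 (z + 1) (by omega)
      rw [rowsHeight, height_succ, height_zero] at this
      rw [rowsHeight]
      omega
    obtain ⟨l', a1, a2, a3⟩ := wordF_append_of_lt (hL 0)
      (show wordEps i (rowsWord r (fun x => L (x + 1))) < (L 0).count i by omega)
    refine ⟨l', a1, a2, ?_⟩
    rw [rowsWord_succ, a3, rowsWord_succ]
    simp
  | r + 1, L, hL, h0, x + 1, hx => by
    have he := wordEps_rowsWord_le (i := i) (r := r) (L := fun x => L (x + 1)) (fun x => hL _)
      (fun x hx => h0 _ (by omega))
    have hx' : IsLastMin (rowsHeight i fun x => L (x + 1)) x := by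
      refine ⟨fun y hy => ?_, fun y hy => ?_⟩
      · have := hx.1 (y + 1) (by omega)
        rw [rowsHeight, height_succ, height_succ] at this
        rw [rowsHeight]; omega
      · have := hx.2 (y + 1) (by omega)
        rw [rowsHeight, height_succ, height_succ] at this
        rw [rowsHeight]; omega
    obtain ⟨l', a1, a2, a3⟩ := wordF_rowsWord_of_isLastMin (r := r) (fun x => hL (x + 1))
      (fun x hx => h0 _ (by omega)) hx'
    refine ⟨l', a1, a2, ?_⟩
    rw [rowsWord_succ, wordF_append_of_le (hL 0), a3, rowsWord_succ]
    · simp only [Option.map_some, Option.some.injEq]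
      rw [Function.update_of_ne (by omega)]
      congr 2
      funext y
      simp [Function.update_apply]
    · by_contra hlt
      have h1 := (he ((L 0).count i - 1)).1 (by omega) x
      have h2 := hx.1 0 (by omega)
      rw [rowsHeight, height_succ, height_zero] at h2
      rw [rowsHeight] at h1
      omega

theorem exists_isLastMin_of_wordF {i : ℕ} : ∀ {r : ℕ} {L : ℕ → List ℕ},
    (∀ x, (L x).Pairwise (· ≥ ·)) → (∀ x, r ≤ x → L x = []) →
    ∀ {w : List ℕ}, wordF i (rowsWord r L) = some w → ∃ x, IsLastMin (rowsHeight i L) x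
  | 0, L, _, h0, w, h => by simp [rowsWord, wordF] at h
  | r + 1, L, hL, h0, w, h => by
    have he := wordEps_rowsWord_le (i := i) (r := r) (L := fun x => L (x + 1)) (fun x => hL _)
      (fun x hx => h0 _ (by omega))
    rcases lt_or_ge (wordEps i (rowsWord r fun x => L (x + 1))) ((L 0).count i) with hlt | hge
    · refine ⟨0, by simp, ?_⟩
      rintro (_ | z) hz
      · omega
      · have := (he ((L 0).count i - 1)).1 (by omega) z
        rw [rowsHeight, height_succ, height_zero]
        rw [rowsHeight] at this
        omega
    · rw [rowsWord_succ, wordF_append_of_le (hL 0) hge] at h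
      obtain ⟨v, hv, -⟩ := Option.map_eq_some_iff.1 h
      obtain ⟨x, hx⟩ := exists_isLastMin_of_wordF (r := r) (fun x => hL (x + 1))
        (fun x hx => h0 _ (by omega)) hv
      refine ⟨x + 1, ?_, ?_⟩
      · rintro (_ | y) hy
        · by_contra hlt
          rw [rowsHeight, height_succ, height_zero] at hlt
          have hmin : ∀ z, rowsHeight i (fun x => L (x + 1)) x ≤
              rowsHeight i (fun x => L (x + 1)) z := fun z => by
            rcases lt_trichotomy z x with h | rfl | h
            · exact hx.1 z h
            · exact le_rfl
            · exact (hx.2 z h).le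
          have hz := hmin 0
          have h1 := (he ((L 0).count i - 1)).2 fun z => by
            have := hmin z
            simp only [rowsHeight, height_zero] at hz this ⊢
            omega
          simp only [rowsHeight, height_zero] at hz
          omega
        · have := hx.1 y (by omega)
          rw [rowsHeight, height_succ, height_succ]
          rw [rowsHeight] at this; omega
      · rintro (_ | y) hy
        · omega
        · have := hx.2 y (by omega)
          rw [rowsHeight, height_succ, height_succ]
          rw [rowsHeight] at this; omega

/-! ### Tableaux as arrays -/

/-- `arr n s S x a` is the number of entries `a` in row `x` (columns `0, …, s - 1`) of the filling
`S`.  Only letters `1 ≤ a < n` are counted. -/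
def arr (n s : ℕ) (S : ℕ → ℕ → ℕ) (x a : ℕ) : ℕ :=
  if 1 ≤ a ∧ a < n then ((Finset.range s).filter fun j => S x j = a).card else 0

theorem arr_eq_card {n s : ℕ} {S : ℕ → ℕ → ℕ} {x a : ℕ} (h1 : 1 ≤ a) (h2 : a < n) :
    arr n s S x a = ((Finset.range s).filter fun j => S x j = a).card := if_pos ⟨h1, h2⟩

theorem arr_eq_zero {n s : ℕ} {S : ℕ → ℕ → ℕ} {x a : ℕ} (h : ¬(1 ≤ a ∧ a < n)) :
    arr n s S x a = 0 := if_neg h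

theorem arr_pos {n s : ℕ} {S : ℕ → ℕ → ℕ} {x a : ℕ} :
    0 < arr n s S x a ↔ 1 ≤ a ∧ a < n ∧ ∃ j < s, S x j = a := by
  unfold arr
  split_ifs with h
  · simp [Finset.card_pos, Finset.Nonempty, h]
  · simp only [lt_self_iff_false, false_iff]
    tauto

theorem arr_setCell {n s : ℕ} (S : ℕ → ℕ → ℕ) {x j : ℕ} (v : ℕ) (hj : j < s) (y a : ℕ) :
    arr n s (setCell S x j v) y a + (if y = x ∧ S x j = a ∧ 1 ≤ a ∧ a < n then 1 else 0) =
      arr n s S y a + (if y = x ∧ v = a ∧ 1 ≤ a ∧ a < n then 1 else 0) := by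
  unfold arr
  by_cases h : 1 ≤ a ∧ a < n
  · simp only [h, and_true, if_true]
    by_cases hy : y = x
    · subst hy
      have e : ∀ S : ℕ → ℕ → ℕ, ((Finset.range s).filter fun j => S y j = a).card =
          (if S y j = a then 1 else 0) + ∑ c ∈ (Finset.range s).erase j,
            if S y c = a then 1 else 0 := fun S => by
        rw [Finset.card_filter, Finset.add_sum_erase _ (fun c => if S y c = a then 1 else 0)
          (Finset.mem_range.2 hj)]
      rw [e, e]
      have : ∑ c ∈ (Finset.range s).erase j, (if setCell S y j v y c = a then 1 else 0) =
          ∑ c ∈ (Finset.range s).erase j, if S y c = a then 1 else 0 :=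
        Finset.sum_congr rfl fun c hc => by
          simp [setCell, (Finset.mem_erase.1 hc).1]
      rw [this]
      simp only [setCell, and_self, if_true, true_and]
      omega
    · simp [setCell, hy]
  · simp [h]

namespace SST

variable {n r s : ℕ}

theorem mem_rect {i j : ℕ} : (i, j) ∈ rect r s ↔ i < r ∧ j < s := by
  change (i, j) ∈ (Finset.range r ×ˢ Finset.range s) ↔ _
  simp

theorem one_le_fill (T : SST n r s) {i j : ℕ} (hi : i < r) (hj : j < s) : 1 ≤ T.fill i j :=
  (T.2 i j (mem_rect.2 ⟨hi, hj⟩)).1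

theorem fill_eq_zero (T : SST n r s) {i j : ℕ} (h : ¬(i < r ∧ j < s)) : T.fill i j = 0 :=
  T.1.zeros' (mt mem_rect.1 h)

theorem fill_le (T : SST n r s) (i j : ℕ) : T.fill i j ≤ n := by
  by_cases h : i < r ∧ j < s
  · exact (T.2 i j (mem_rect.2 h)).2
  · simp [T.fill_eq_zero h]

theorem fill_row_le (T : SST n r s) {i j j' : ℕ} (hi : i < r) (hj : j ≤ j') (hj' : j' < s) :
    T.fill i j ≤ T.fill i j' :=
  T.1.row_weak_of_le hj (mem_rect.2 ⟨hi, hj'⟩)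

theorem fill_col_lt (T : SST n r s) {i i' j : ℕ} (hi : i < i') (hi' : i' < r) (hj : j < s) :
    T.fill i j < T.fill i' j :=
  T.1.col_strict hi (mem_rect.2 ⟨hi', hj⟩)

theorem fill_injective : Function.Injective (fill : SST n r s → ℕ → ℕ → ℕ) := fun _ _ h =>
  Subtype.ext (DFunLike.coe_injective h)

theorem exists_fill_eq {S : ℕ → ℕ → ℕ} (hpos : ∀ i j, i < r → j < s → 1 ≤ S i j)
    (hle : ∀ i j, i < r → j < s → S i j ≤ n) (h0 : ∀ i j, ¬(i < r ∧ j < s) → S i j = 0)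
    (hrow : ∀ i j, i < r → j + 1 < s → S i j ≤ S i (j + 1))
    (hcol : ∀ i j, i + 1 < r → j < s → S i j < S (i + 1) j) : ∃ T : SST n r s, T.fill = S := by
  refine ⟨⟨⟨S, ?_, ?_, fun h => h0 _ _ (mt mem_rect.2 h)⟩, fun i j h =>
    have h := mem_rect.1 h; ⟨hpos i j h.1 h.2, hle i j h.1 h.2⟩⟩, rfl⟩
  · intro i j j' hj h
    obtain ⟨h1, h2⟩ := mem_rect.1 h
    clear h
    induction j', hj using Nat.le_induction with
    | base => exact hrow i j h1 h2
    | succ k _ ih => exact (ih (by omega)).trans (hrow i k h1 h2)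
  · intro i i' j hi h
    obtain ⟨h1, h2⟩ := mem_rect.1 h
    clear h
    induction i', hi using Nat.le_induction with
    | base => exact hcol i j h1 h2
    | succ k _ ih => exact (ih (by omega)).trans (hcol k j h1 h2)

instance : Finite (SST n r s) := by
  refine Finite.of_injective (β := Fin r → Fin s → Fin (n + 1))
    (fun T i j => ⟨T.fill i j, Nat.lt_succ_of_le (T.fill_le i j)⟩) fun T T' h =>
      fill_injective ?_
  funext i j
  by_cases hij : i < r ∧ j < s
  · have := congrFun (congrFun h ⟨i, hij.1⟩) ⟨j, hij.2⟩
    simpa using this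
  · rw [T.fill_eq_zero hij, T'.fill_eq_zero hij]

theorem succ_le_fill (T : SST n r s) {i j : ℕ} (hi : i < r) (hj : j < s) : i + 1 ≤ T.fill i j := by
  induction i with
  | zero => exact T.one_le_fill hi hj
  | succ i ih =>
    have := T.fill_col_lt (Nat.lt_add_one i) hi hj
    have := ih (by omega)
    omega

theorem fill_add_le (T : SST n r s) {j : ℕ} (hj : j < s) (d : ℕ) : ∀ {i : ℕ}, i + d < r →
    T.fill i j + d ≤ n := by
  induction d with
  | zero => intro i _; exact T.fill_le i j
  | succ d ih =>
    intro i hi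
    have := T.fill_col_lt (Nat.lt_add_one i) (by omega) hj
    have := ih (i := i + 1) (by omega)
    omega

/-- The array of multiplicities of the letters `1, …, n` in the rows of a tableau. -/
def array (T : SST n r s) : ℕ → ℕ → ℕ := arr (n + 1) s T.fill

theorem array_of_row_ge (T : SST n r s) {x : ℕ} (hx : r ≤ x) (a : ℕ) : T.array x a = 0 := by
  by_contra h
  obtain ⟨h1, -, j, -, h2⟩ := arr_pos.1 (Nat.pos_of_ne_zero h)
  rw [T.fill_eq_zero (by omega)] at h2
  omega

theorem array_of_not_mem (T : SST n r s) {a : ℕ} (ha : ¬(1 ≤ a ∧ a ≤ n)) (x : ℕ) :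
    T.array x a = 0 := arr_eq_zero (by omega)

theorem array_pos {T : SST n r s} {x a : ℕ} : 0 < T.array x a ↔
    x < r ∧ 1 ≤ a ∧ ∃ j < s, T.fill x j = a := by
  constructor
  · intro h
    obtain ⟨h1, -, h2⟩ := arr_pos.1 h
    refine ⟨?_, h1, h2⟩
    by_contra hx
    rw [T.array_of_row_ge (by omega)] at h
    omega
  · rintro ⟨-, h1, j, hj, h2⟩
    exact arr_pos.2 ⟨h1, by have := T.fill_le x j; omega, j, hj, h2⟩

theorem sum_array (T : SST n r s) {x : ℕ} (hx : x < r) :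
    ∑ a ∈ Finset.range (n + 1), T.array x a = s := by
  have h := Finset.card_eq_sum_card_fiberwise (s := Finset.range s) (t := Finset.range (n + 1))
    (f := T.fill x) fun j _ => by
      have := T.fill_le x j
      simp only [Finset.coe_range, Set.mem_Iio]; omega
  rw [Finset.card_range] at h
  refine Eq.trans (Finset.sum_congr rfl fun a ha => ?_) h.symm
  by_cases h1 : 1 ≤ a
  · exact arr_eq_card h1 (Finset.mem_range.1 ha)
  · rw [T.array_of_not_mem (by omega), eq_comm, Finset.card_eq_zero, Finset.filter_eq_empty_iff]
    intro j hj
    have := T.one_le_fill hx (Finset.mem_range.1 hj)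
    omega

/-- The rows of a tableau, read from right to left. -/
def rowList (T : SST n r s) (x : ℕ) : List ℕ :=
  if x < r then (List.range s).reverse.map fun j => T.fill x j else []

theorem word_eq (T : SST n r s) : T.word = rowsWord r T.rowList := by
  unfold word rowsWord
  refine List.flatMap_congr fun x hx => ?_
  rw [rowList, if_pos (List.mem_range.1 hx)]

theorem rowList_of_ge (T : SST n r s) {x : ℕ} (hx : r ≤ x) : T.rowList x = [] :=
  if_neg (by omega)

theorem pairwise_rowList (T : SST n r s) (x : ℕ) : (T.rowList x).Pairwise (· ≥ ·) := by
  unfold rowList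
  split_ifs with hx
  · rw [List.map_reverse, List.pairwise_reverse, List.pairwise_map]
    refine List.Pairwise.imp_of_mem ?_ List.pairwise_lt_range
    intro a b _ hb hab
    exact T.fill_row_le hx hab.le (List.mem_range.1 hb)
  · exact List.Pairwise.nil

theorem count_rowList (T : SST n r s) (x : ℕ) (a : ℕ) : (T.rowList x).count a = T.array x a := by
  by_cases hx : x < r
  · have e : (T.rowList x).count a = ((Finset.range s).filter fun j => T.fill x j = a).card := by
      rw [rowList, if_pos hx, List.map_reverse, List.count_reverse, ← Multiset.coe_count,
        ← Multiset.map_coe, Multiset.count_map]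
      simp only [eq_comm]
      rfl
    by_cases ha : 1 ≤ a ∧ a < n + 1
    · rw [e]; exact (arr_eq_card ha.1 ha.2).symm
    · rw [e, T.array_of_not_mem (by omega), Finset.card_eq_zero, Finset.filter_eq_empty_iff]
      intro j hj
      have := T.one_le_fill hx (Finset.mem_range.1 hj)
      have := T.fill_le x j
      omega
  · rw [T.rowList_of_ge (by omega), T.array_of_row_ge (by omega)]; rfl

theorem mult_eq (T : SST n r s) (a : ℕ) : T.mult a = ∑ x ∈ Finset.range r, T.array x a := by
  rw [mult, word_eq, rowsWord, List.count_flatMap]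
  simp only [Function.comp_def, count_rowList]
  rfl

theorem eq_of_pairwise_of_count {l l' : List ℕ} (h : l.Pairwise (· ≥ ·)) (h' : l'.Pairwise (· ≥ ·))
    (hc : ∀ a, l.count a = l'.count a) : l = l' :=
  List.Perm.eq_of_pairwise (fun _ _ _ _ h1 h2 => le_antisymm h2 h1) h h' (List.perm_iff_count.2 hc)

theorem fill_eq_of_rowList_eq {T T' : SST n r s} (h : T.rowList = T'.rowList) : T = T' := by
  apply fill_injective
  funext i j
  by_cases hij : i < r ∧ j < s
  · have := congrFun h i
    rw [rowList, rowList, if_pos hij.1, if_pos hij.1, List.map_inj_left] at this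
    exact this j (by simpa using hij.2)
  · rw [T.fill_eq_zero hij, T'.fill_eq_zero hij]

theorem array_injective : Function.Injective (array : SST n r s → ℕ → ℕ → ℕ) := fun T T' h =>
  fill_eq_of_rowList_eq <| funext fun x => eq_of_pairwise_of_count (T.pairwise_rowList x)
    (T'.pairwise_rowList x) fun a => by rw [count_rowList, count_rowList, h]

theorem word_injective : Function.Injective (word : SST n r s → List ℕ) := by
  intro T T' h
  rw [word_eq, word_eq] at h
  have key : ∀ (r : ℕ) (L L' : ℕ → List ℕ), (∀ x < r, (L x).length = (L' x).length) →
      rowsWord r L = rowsWord r L' → ∀ x < r, L x = L' x := by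
    intro r
    induction r with
    | zero => intro _ _ _ _ x hx; omega
    | succ r ih =>
      intro L L' hl h x hx
      rw [rowsWord_succ, rowsWord_succ] at h
      obtain ⟨h1, h2⟩ := List.append_inj h (hl 0 (by omega))
      cases x with
      | zero => exact h1
      | succ x => exact ih _ _ (fun y hy => hl (y + 1) (by omega)) h2 x (by omega)
  refine fill_eq_of_rowList_eq (funext fun x => ?_)
  by_cases hx : x < r
  · exact key r _ _ (fun y hy => by simp [rowList, hy]) h x hx
  · rw [T.rowList_of_ge (by omega), T'.rowList_of_ge (by omega)]

/-! ### Crystal operators on tableaux -/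

/-- `T' = f̃_i T`, in terms of the arrays of multiplicities. -/
def FStep (i : ℕ) (T T' : SST n r s) : Prop := LetterStep i T.array T'.array

/-- The height function of the `i`-brackets of a tableau. -/
def ht (i : ℕ) (T : SST n r s) : ℕ → ℤ :=
  height (fun x => T.array x i) (fun x => T.array x (i + 1))

theorem ht_eq (i : ℕ) (T : SST n r s) : T.ht i = rowsHeight i T.rowList := by
  unfold ht rowsHeight
  simp only [count_rowList]

theorem FStep.unique {i : ℕ} {T U U' : SST n r s} (h : FStep i T U) (h' : FStep i T U') : U = U' :=
  array_injective (LetterStep.unique h h')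

theorem FStep.unique_left {i : ℕ} {T T' U : SST n r s} (h : FStep i T U) (h' : FStep i T' U) :
    T = T' :=
  array_injective (LetterStep.unique_left h h')

/-- If the bracket rule selects a row, then changing the last `i` of this row into `i + 1` gives a
semistandard tableau: an entry `i + 1` below it would force at least as many letters `i + 1` in the
row below as there are letters `i` in the selected row. -/
theorem exists_fStep {i x : ℕ} (hi : 1 ≤ i) (hin : i < n) (T : SST n r s)
    (hx : IsLastMin (T.ht i) x) : ∃ T', FStep i T T' := by
  have h1 := hx.2 (x + 1) (by omega)
  have h2 := height_succ_sub (fun y => T.array y i) (fun y => T.array y (i + 1)) x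
  change T.ht i (x + 1) - T.ht i x = _ at h2
  have hlt : T.array (x + 1) (i + 1) < T.array x i := by omega
  obtain ⟨hxr, -, j, hj, hji⟩ := array_pos.1 (show 0 < T.array x i by omega)
  obtain ⟨j₀, hm, hmax⟩ := Finset.exists_max_image
    ((Finset.range s).filter fun j => T.fill x j = i) id ⟨j, by simp [hj, hji]⟩
  simp only [Finset.mem_filter, Finset.mem_range, id] at hm hmax
  have hright : ∀ j, j₀ < j → j < s → i < T.fill x j := fun j h h' => by
    have := T.fill_row_le hxr h.le h'
    have : T.fill x j ≠ i := fun e => by have := hmax j ⟨h', e⟩; omega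
    omega
  have hbelow : x + 1 < r → i + 1 < T.fill (x + 1) j₀ := fun hr => by
    have h3 := T.fill_col_lt (Nat.lt_add_one x) hr hm.1
    by_contra h4
    have h5 : T.array x i ≤ T.array (x + 1) (i + 1) := by
      rw [array, arr_eq_card hi (by omega), arr_eq_card (by omega) (by omega)]
      refine Finset.card_le_card fun c hc => ?_
      simp only [Finset.mem_filter, Finset.mem_range] at hc ⊢
      have := T.fill_col_lt (Nat.lt_add_one x) hr hc.1
      have := T.fill_row_le hr (hmax c hc) hm.1
      refine ⟨hc.1, ?_⟩
      omega
    omega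
  obtain ⟨T', hT'⟩ := exists_fill_eq (n := n) (r := r) (s := s) (S := setCell T.fill x j₀ (i + 1))
    (fun a b ha hb => by
      have := T.one_le_fill ha hb
      unfold setCell; split_ifs <;> omega)
    (fun a b ha hb => by
      have := T.fill_le a b
      unfold setCell; split_ifs <;> omega)
    (fun a b h => by
      have := T.fill_eq_zero h
      unfold setCell; rw [if_neg, this]
      rintro ⟨rfl, rfl⟩
      exact h ⟨hxr, hm.1⟩)
    (fun a b ha hb => by
      have := T.fill_row_le ha (Nat.le_add_right b 1) hb
      unfold setCell
      split_ifs with h3 h4 h4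
      · omega
      · obtain ⟨rfl, rfl⟩ := h3
        exact hright _ (by omega) hb
      · obtain ⟨rfl, h4⟩ := h4
        rw [h4, hm.2] at this; omega
      · exact this)
    (fun a b ha hb => by
      have := T.fill_col_lt (Nat.lt_add_one a) ha hb
      unfold setCell
      split_ifs with h3 h4 h4
      · omega
      · obtain ⟨rfl, rfl⟩ := h3
        exact hbelow ha
      · obtain ⟨h4, rfl⟩ := h4
        rw [h4, hm.2] at this; omega
      · exact this)
  refine ⟨T', x, hx, fun y a => ?_⟩
  have := arr_setCell (n := n + 1) T.fill (x := x) (i + 1) hm.1 y a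
  rw [← hT', hm.2] at this
  change T'.array y a + _ = T.array y a + _ at this
  split_ifs at this ⊢ <;> omega

theorem FStep.wordF_eq {i : ℕ} {T T' : SST n r s} (h : FStep i T T') :
    wordF i T.word = some T'.word := by
  obtain ⟨x, hx, hN⟩ := h
  change IsLastMin (T.ht i) x at hx
  rw [ht_eq] at hx
  obtain ⟨l', h1, h2, h3⟩ := wordF_rowsWord_of_isLastMin T.pairwise_rowList
    (fun _ => T.rowList_of_ge) hx
  rw [word_eq, h3, word_eq]
  congr 2
  funext y
  by_cases hy : y = x
  · subst hy
    rw [Function.update_self]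
    refine eq_of_pairwise_of_count h1 (T'.pairwise_rowList y) fun a => ?_
    have e1 := h2 a
    have e2 := hN y a
    rw [count_rowList] at e1 ⊢
    simp only [true_and] at e2
    split_ifs at e1 e2 <;> omega
  · rw [Function.update_of_ne hy]
    refine eq_of_pairwise_of_count (T.pairwise_rowList y) (T'.pairwise_rowList y) fun a => ?_
    have e2 := hN y a
    rw [count_rowList, count_rowList]
    simp only [hy, false_and, if_false] at e2
    omega

theorem wordF_eq_some_word_iff {i : ℕ} (hi : 1 ≤ i) (hin : i < n) {T T' : SST n r s} :
    wordF i T.word = some T'.word ↔ FStep i T T' := by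
  refine ⟨fun h => ?_, FStep.wordF_eq⟩
  have h' := h
  rw [word_eq] at h'
  obtain ⟨x, hx⟩ := exists_isLastMin_of_wordF T.pairwise_rowList (fun _ => T.rowList_of_ge) h'
  rw [← ht_eq] at hx
  obtain ⟨U, hU⟩ := exists_fStep hi hin T hx
  have := hU.wordF_eq
  rw [h, Option.some.injEq] at this
  rwa [word_injective this]

theorem f_eq_some_iff {i : ℕ} (hi : 1 ≤ i) (hin : i < n) {T T' : SST n r s} :
    T.f i = some T' ↔ FStep i T T' := by
  rw [← wordF_eq_some_word_iff hi hin]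
  unfold f
  constructor
  · intro h
    split_ifs at h with hex
    rw [← Option.some.inj h]
    exact hex.choose_spec
  · intro h
    have hex : ∃ T' : SST n r s, wordF i T.word = some T'.word := ⟨T', h⟩
    rw [dif_pos hex, Option.some.injEq]
    exact word_injective (Option.some.inj (hex.choose_spec.symm.trans h))

theorem e_eq_some_iff {i : ℕ} (hi : 1 ≤ i) (hin : i < n) {T T' : SST n r s} :
    T.e i = some T' ↔ FStep i T' T := by
  rw [← wordF_eq_some_word_iff hi hin, ← wordE_eq_some_iff]
  unfold e
  constructor
  · intro h
    split_ifs at h with hex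
    rw [← Option.some.inj h]
    exact hex.choose_spec
  · intro h
    have hex : ∃ T' : SST n r s, wordE i T.word = some T'.word := ⟨T', h⟩
    rw [dif_pos hex, Option.some.injEq]
    exact word_injective (Option.some.inj (hex.choose_spec.symm.trans h))

/-- The effect of `f̃_i` on the weight. -/
theorem FStep.mult {i : ℕ} {T T' : SST n r s} (h : FStep i T T') (a : ℕ) :
    T'.mult a + (if a = i then 1 else 0) = T.mult a + (if a = i + 1 then 1 else 0) := by
  obtain ⟨x, hx, hN⟩ := h
  have hxr : x < r := by
    by_contra hxr
    have h1 := hx.2 (x + 1) (by omega)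
    have h2 := height_succ_sub (fun y => T.array y i) (fun y => T.array y (i + 1)) x
    rw [T.array_of_row_ge (by omega)] at h2
    omega
  have h3 := Finset.sum_congr (rfl : Finset.range r = Finset.range r) fun y _ => hN y a
  rw [Finset.sum_add_distrib, Finset.sum_add_distrib] at h3
  have e : ∀ P : Prop, [Decidable P] → ∑ y ∈ Finset.range r,
      (if y = x ∧ P then (1 : ℤ) else 0) = if P then 1 else 0 := by
    intro P _
    by_cases p : P <;> simp [p, hxr]
  rw [e, e] at h3
  rw [mult_eq, mult_eq]
  zify
  exact_mod_cast h3

/-! ### The rotation by 180 degrees -/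

theorem exists_rot (T : SST n r s) : ∃ U : SST n r s, U.fill = fun i j =>
    if i < r ∧ j < s then n + 1 - T.fill (r - 1 - i) (s - 1 - j) else 0 := by
  refine exists_fill_eq (fun i j hi hj => ?_) (fun i j hi hj => ?_) (fun i j h => if_neg h)
    (fun i j hi hj => ?_) fun i j hi hj => ?_
  · have := T.fill_le (r - 1 - i) (s - 1 - j)
    rw [if_pos ⟨hi, hj⟩]; omega
  · have := T.one_le_fill (show r - 1 - i < r by omega) (show s - 1 - j < s by omega)
    rw [if_pos ⟨hi, hj⟩]; omega
  · have := T.fill_row_le (show r - 1 - i < r by omega)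
      (show s - 1 - (j + 1) ≤ s - 1 - j by omega) (by omega)
    rw [if_pos ⟨hi, by omega⟩, if_pos ⟨hi, hj⟩]; omega
  · have := T.fill_col_lt (show r - 1 - (i + 1) < r - 1 - i by omega) (by omega)
      (show s - 1 - j < s by omega)
    have := T.fill_le (r - 1 - i) (s - 1 - j)
    rw [if_pos ⟨by omega, hj⟩, if_pos ⟨hi, hj⟩]; omega

/-- The rotation of a rectangular tableau by 180 degrees, with each entry `a` replaced by
`n + 1 - a`.  It reverses and complements the reading word. -/
noncomputable def rot (T : SST n r s) : SST n r s := T.exists_rot.choose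

theorem rot_fill (T : SST n r s) : T.rot.fill = fun i j =>
    if i < r ∧ j < s then n + 1 - T.fill (r - 1 - i) (s - 1 - j) else 0 :=
  T.exists_rot.choose_spec

theorem rot_fill_apply (T : SST n r s) {i j : ℕ} (hi : i < r) (hj : j < s) :
    T.rot.fill i j = n + 1 - T.fill (r - 1 - i) (s - 1 - j) := by
  rw [rot_fill]
  exact if_pos ⟨hi, hj⟩

theorem rot_rot (T : SST n r s) : T.rot.rot = T := by
  apply fill_injective
  funext i j
  by_cases h : i < r ∧ j < s
  · have := T.fill_le i j
    rw [rot_fill_apply _ h.1 h.2, rot_fill_apply _ (by omega) (by omega),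
      show r - 1 - (r - 1 - i) = i by omega, show s - 1 - (s - 1 - j) = j by omega]
    omega
  · rw [fill_eq_zero _ h, T.fill_eq_zero h]

theorem rot_array (T : SST n r s) {x : ℕ} (hx : x < r) (a : ℕ) :
    T.rot.array x a = T.array (r - 1 - x) (n + 1 - a) := by
  by_cases ha : 1 ≤ a ∧ a ≤ n
  · rw [array, array, arr_eq_card (by omega) (by omega), arr_eq_card (by omega) (by omega),
      Finset.card_filter, Finset.card_filter, ← Finset.sum_range_reflect]
    refine Finset.sum_congr rfl fun j hj => ?_
    rw [Finset.mem_range] at hj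
    have := T.fill_le (r - 1 - x) j
    rw [rot_fill_apply _ hx (by omega), show s - 1 - (s - 1 - j) = j by omega]
    congr 1
    apply propext
    omega
  · rw [array_of_not_mem _ ha, array_of_not_mem _ (by omega)]

theorem rot_mult (T : SST n r s) (a : ℕ) : T.rot.mult a = T.mult (n + 1 - a) := by
  rw [mult_eq, mult_eq, ← Finset.sum_range_reflect]
  refine Finset.sum_congr rfl fun x hx => ?_
  rw [Finset.mem_range] at hx
  rw [rot_array _ (by omega), show r - 1 - (r - 1 - x) = x by omega]

end SST

/-- The height function of a reversed bracket sequence. -/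
theorem height_reverse {p q p' q' : ℕ → ℕ} {r : ℕ} (hp : ∀ y < r, p' y = q (r - 1 - y))
    (hq : ∀ y < r, q' y = p (r - 1 - y)) (hp0 : ∀ y, r ≤ y → p' y = 0)
    (hq0 : ∀ y, r ≤ y → q' y = 0) (z : ℕ) :
    height p' q' z = (if z < r then height p q (r - 1 - z) else 0)
      - (∑ y ∈ Finset.range r, (p y : ℤ) - ∑ y ∈ Finset.range r, (q y : ℤ)) := by
  induction z with
  | zero =>
    rw [height_zero]
    split_ifs with hr
    · obtain ⟨r, rfl⟩ : ∃ r', r = r' + 1 := ⟨r - 1, by omega⟩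
      rw [hq 0 hr]
      simp only [Nat.add_sub_cancel, Nat.sub_zero, height, Finset.sum_range_succ]
      ring
    · obtain rfl : r = 0 := by omega
      simp [hq0]
  | succ z ih =>
    have h := height_succ_sub p' q' z
    rcases lt_trichotomy (z + 1) r with hz | hz | hz
    · rw [if_pos (by omega)] at ih
      have h2 := height_succ_sub p q (r - 1 - (z + 1))
      rw [show r - 1 - (z + 1) + 1 = r - 1 - z by omega] at h2
      rw [hp z (by omega), hq (z + 1) hz] at h
      rw [if_pos hz]
      omega
    · rw [if_pos (by omega), show r - 1 - z = 0 by omega, height_zero] at ih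
      rw [hp z (by omega), hq0 _ (by omega), show r - 1 - z = 0 by omega] at h
      rw [if_neg (by omega)]
      omega
    · rw [if_neg (by omega)] at ih
      rw [hp0 z (by omega), hq0 _ (by omega)] at h
      rw [if_neg (by omega)]
      omega

namespace SST

variable {n r s : ℕ}

/-- The rotation exchanges `f̃_i` and `ẽ_{n-i}`. -/
theorem FStep.rot {i : ℕ} (hi : 1 ≤ i) (hin : i < n) {T T' : SST n r s} (h : FStep i T T') :
    FStep (n - i) T'.rot T.rot := by
  obtain ⟨x, hx, hN⟩ := h
  have hD := height_letter_of_move hN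
  have hxr : x < r := by
    by_contra hxr
    have h1 := hx.2 (x + 1) (by omega)
    have h2 := height_succ_sub (fun y => T.array y i) (fun y => T.array y (i + 1)) x
    rw [T.array_of_row_ge (by omega)] at h2
    omega
  have hH := height_reverse (p := fun y => T'.array y i) (q := fun y => T'.array y (i + 1))
    (p' := fun y => T'.rot.array y (n - i)) (q' := fun y => T'.rot.array y (n - i + 1)) (r := r)
    (fun y hy => by rw [rot_array _ hy]; congr 1; omega)
    (fun y hy => by rw [rot_array _ hy]; congr 1; omega)
    (fun y hy => array_of_row_ge _ hy _) (fun y hy => array_of_row_ge _ hy _)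
  refine ⟨r - 1 - x, ⟨fun y hy => ?_, fun y hy => ?_⟩, fun y a => ?_⟩
  · rw [hH, hH, if_pos (by omega), if_pos (by omega), hD, hD,
      show r - 1 - (r - 1 - x) = x by omega]
    have := hx.2 (r - 1 - y) (by omega)
    split_ifs <;> omega
  · rw [hH, hH, if_pos (by omega), hD, show r - 1 - (r - 1 - x) = x by omega]
    by_cases hy' : y < r
    · rw [if_pos hy', hD]
      have := hx.1 (r - 1 - y) (by omega)
      split_ifs <;> omega
    · rw [if_neg hy']
      have h0 := height_zero (fun y => T.array y i) (fun y => T.array y (i + 1))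
      have : height (fun y => T.array y i) (fun y => T.array y (i + 1)) x ≤
          height (fun y => T.array y i) (fun y => T.array y (i + 1)) 0 := by
        rcases Nat.eq_zero_or_pos x with rfl | h
        · exact le_rfl
        · exact hx.1 0 h
      split_ifs <;> omega
  · by_cases hy : y < r
    · have := hN (r - 1 - y) (n + 1 - a)
      rw [rot_array _ hy, rot_array _ hy]
      split_ifs at this ⊢ <;> omega
    · rw [array_of_row_ge _ (by omega), array_of_row_ge _ (by omega)]
      split_ifs <;> omega

end SST

/-! ### Sequences of row operators -/

/-- The composite of the row operators with the given indices, the head of the list being applied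
first. -/
def RowSteps : List ℕ → (ℕ → ℕ → ℕ) → (ℕ → ℕ → ℕ) → Prop
  | [], M, N => M = N
  | t :: l, M, N => ∃ M', RowStep t M M' ∧ RowSteps l M' N

theorem RowSteps.append : ∀ {l l' : List ℕ} {M M' N : ℕ → ℕ → ℕ}, RowSteps l M M' →
    RowSteps l' M' N → RowSteps (l ++ l') M N
  | [], _, _, _, _, h, h' => by
    obtain rfl : _ = _ := h
    exact h'
  | _ :: _, _, _, _, _, ⟨M₁, h₁, h⟩, h' => ⟨M₁, h₁, h.append h'⟩

theorem LetterStep.rowSteps {i : ℕ} : ∀ {l : List ℕ} {M N M' N' : ℕ → ℕ → ℕ}, LetterStep i M N →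
    RowSteps l M M' → RowSteps l N N' → LetterStep i M' N'
  | [], _, _, _, _, h, h₁, h₂ => by
    obtain rfl : _ = _ := h₁
    obtain rfl : _ = _ := h₂
    exact h
  | _ :: _, _, _, _, _, h, ⟨_, h₁, h₁'⟩, ⟨_, h₂, h₂'⟩ => (h.rowStep h₁ h₂).rowSteps h₁' h₂'

theorem RowSteps.exists_isLastMin {i : ℕ} : ∀ {l : List ℕ} {M M' : ℕ → ℕ → ℕ}, RowSteps l M M' →
    (∃ x, IsLastMin (height (fun y => M' y i) (fun y => M' y (i + 1))) x) →
    ∃ x, IsLastMin (height (fun y => M y i) (fun y => M y (i + 1))) x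
  | [], _, _, h, h' => by
    obtain rfl : _ = _ := h
    exact h'
  | _ :: _, _, _, ⟨_, h₁, h⟩, h' =>
    have ⟨_, hx⟩ := h.exists_isLastMin h'
    h₁.exists_isLastMin hx

theorem RowSteps.sum_eq {r : ℕ} (a : ℕ) : ∀ {l : List ℕ} {M M' : ℕ → ℕ → ℕ}, RowSteps l M M' →
    (∀ t ∈ l, t + 1 < r) → ∑ x ∈ Finset.range r, M' x a = ∑ x ∈ Finset.range r, M x a
  | [], _, _, h, _ => by
    obtain rfl : _ = _ := h
    rfl
  | t :: l, M, N, ⟨M', ⟨b, _, hM⟩, h⟩, hl => by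
    rw [h.sum_eq a fun t ht => hl t (List.mem_cons_of_mem _ ht)]
    have ht := hl t List.mem_cons_self
    have h3 := Finset.sum_congr (rfl : Finset.range r = Finset.range r) fun y _ => hM a y
    simp only [Function.swap] at h3
    rw [Finset.sum_add_distrib, Finset.sum_add_distrib] at h3
    have e : ∀ u, u < r → ∑ y ∈ Finset.range r, (if a = b ∧ y = u then (1 : ℤ) else 0) =
        if a = b then 1 else 0 := by
      intro u hu
      by_cases p : a = b <;> simp [p, hu]
    rw [e t (by omega), e (t + 1) ht] at h3
    zify
    omega

/-! ### Jeu de taquin slides -/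

/-- The conditions on a filling `S` of the rectangle met during promotion, for the cells outside the
set `H` of holes: rows increase weakly and columns strictly, the entries `0` are the first `z` cells
of the top row, and the letters are less than `n`, apart from letters `n` in the bottom row from
column `c₀` on. -/
structure IsFilling (n r s : ℕ) (H : ℕ → ℕ → Prop) (S : ℕ → ℕ → ℕ) (z c₀ : ℕ) : Prop where
  row : ∀ x j j', x < r → j < j' → j' < s → ¬H x j → ¬H x j' → S x j ≤ S x j'
  col : ∀ x x' j, x < x' → x' < r → j < s → ¬H x j → ¬H x' j → S x j < S x' j
  zero : ∀ x j, x < r → j < s → ¬H x j → (S x j = 0 ↔ x = 0 ∧ j < z)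
  bound : ∀ x j, x < r → j < s → ¬H x j → S x j < n ∨ (x + 1 = r ∧ c₀ ≤ j ∧ S x j = n)

/-- A bound `E x` in each row `x ≤ i` for the columns which a slide path through that row can reach:
the path must leave row `x + 1` upwards at the latest in column `E (x + 1)`, because there the entry
above is at least the entry to the left. -/
structure IsBarrier (s : ℕ) (S : ℕ → ℕ → ℕ) (z i : ℕ) (E : ℕ → ℕ) : Prop where
  zero : E 0 = z
  mono : ∀ x < i, E x ≤ E (x + 1)
  le : ∀ x < i, E (x + 1) < s → leftOf S (x + 1) (E (x + 1)) ≤ S x (E (x + 1))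

theorem IsBarrier.zero_le {s : ℕ} {S : ℕ → ℕ → ℕ} {z i : ℕ} {E : ℕ → ℕ} (h : IsBarrier s S z i E) :
    ∀ x ≤ i, z ≤ E x := by
  intro x hx
  induction x with
  | zero => exact h.zero.ge
  | succ x ih => exact (ih (by omega)).trans (h.mono x (by omega))

theorem setCell_self (S : ℕ → ℕ → ℕ) (i j v : ℕ) : setCell S i j v i j = v := by simp [setCell]

theorem setCell_of_ne (S : ℕ → ℕ → ℕ) {i j x y : ℕ} (v : ℕ) (h : ¬(x = i ∧ y = j)) :
    setCell S i j v x y = S x y := by simp [setCell, h]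

theorem sum_range_arr (n s : ℕ) (S : ℕ → ℕ → ℕ) (x b : ℕ) :
    ∑ a ∈ Finset.range b, arr n s S x a =
      ((Finset.range s).filter fun j => 1 ≤ S x j ∧ S x j < b ∧ S x j < n).card := by
  induction b with
  | zero => simp
  | succ b ih =>
    rw [Finset.sum_range_succ, ih]
    by_cases h : 1 ≤ b ∧ b < n
    · rw [arr_eq_card h.1 h.2, ← Finset.card_union_of_disjoint]
      · congr 1
        ext j
        simp only [Finset.mem_union, Finset.mem_filter, Finset.mem_range]
        omega
      · rw [Finset.disjoint_filter]
        omega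
    · rw [arr_eq_zero h, add_zero]
      congr 1
      ext j
      simp only [Finset.mem_filter, Finset.mem_range]
      omega

section Slide

variable {n r s z c₀ : ℕ}

/-- Moving an entry down into a hole is a row operator.  In the bracket rule the entries of the two
rows in the other columns are compared columnwise, and the moving entry is the first unmatched
one. -/
theorem rowStep_of_hole {S : ℕ → ℕ → ℕ} {t c : ℕ} (ht : t + 1 < r) (hc : c < s)
    (h : IsFilling n r s (fun x j => x = t + 1 ∧ j = c) S z c₀) (h0 : S t c ≠ 0)
    (hle : leftOf S (t + 1) c ≤ S t c) :
    RowStep t (arr n s (setCell S (t + 1) c 0))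
      (arr n s (setCell (setCell S (t + 1) c (S t c)) t c 0)) := by
  have hvn : S t c < n := by
    have := h.bound t c (by omega) hc (by omega)
    omega
  have hleft : ∀ j < c, S (t + 1) j ≤ S t c := fun j hj => by
    have e : leftOf S (t + 1) c = S (t + 1) (c - 1) := if_neg (by omega)
    rw [e] at hle
    rcases (show j < c - 1 ∨ j = c - 1 by omega) with h1 | rfl
    · exact (h.row (t + 1) j (c - 1) ht h1 (by omega) (by omega) (by omega)).trans hle
    · exact hle
  have hcol : ∀ j < s, j ≠ c → S t j < S (t + 1) j := fun j hj hjc =>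
    h.col t (t + 1) j (by omega) ht hj (by omega) (by omega)
  set A : ℕ → Finset ℕ := fun b => (Finset.range s).filter fun j => S t j < b with hA
  set B : ℕ → Finset ℕ := fun b =>
    (Finset.range s).filter fun j => j ≠ c ∧ S (t + 1) j ≤ b ∧ S (t + 1) j < n with hB
  have hBA : ∀ b, B b ⊆ A b := fun b j hj => by
    simp only [hA, hB, Finset.mem_filter, Finset.mem_range] at hj ⊢
    have := hcol j hj.1 hj.2.1
    omega
  have hBA' : ∀ b, S t c < b → (B b).card < (A b).card := fun b hb =>
    Finset.card_lt_card <| (Finset.ssubset_iff_of_subset (hBA b)).2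
      ⟨c, by simp [hA, hb, hc], by simp [hB]⟩
  have hAB : A (S t c) ⊆ B (S t c) := fun j hj => by
    simp only [hA, hB, Finset.mem_filter, Finset.mem_range] at hj ⊢
    have hjc : j < c := by
      by_contra hjc
      rcases (show j = c ∨ c < j by omega) with rfl | h1
      · omega
      · have := h.row t c j (by omega) h1 hj.1 (by omega) (by omega)
        omega
    have := hleft j hjc
    omega
  -- The entries `0` of row `t`, not counted in the array, shift its height function by a constant.
  have hht : ∀ b, 1 ≤ b → height (arr n s (setCell S (t + 1) c 0) t)
      (arr n s (setCell S (t + 1) c 0) (t + 1)) b = (A b).card - (A 1).card - (B b).card := by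
    intro b hb
    have e1 := sum_range_arr n s (setCell S (t + 1) c 0) t b
    have e2 := sum_range_arr n s (setCell S (t + 1) c 0) (t + 1) (b + 1)
    have a1 : ((Finset.range s).filter fun j => 1 ≤ setCell S (t + 1) c 0 t j ∧
        setCell S (t + 1) c 0 t j < b ∧ setCell S (t + 1) c 0 t j < n) = A b \ A 1 := by
      ext j
      simp only [hA, Finset.mem_sdiff, Finset.mem_filter, Finset.mem_range]
      rw [setCell_of_ne _ _ (by omega)]
      constructor
      · omega
      · intro hj
        have := h.bound t j (by omega) hj.1.1 (by omega)
        omega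
    have a2 : ((Finset.range s).filter fun j => 1 ≤ setCell S (t + 1) c 0 (t + 1) j ∧
        setCell S (t + 1) c 0 (t + 1) j < b + 1 ∧ setCell S (t + 1) c 0 (t + 1) j < n) = B b := by
      ext j
      simp only [hB, Finset.mem_filter, Finset.mem_range]
      by_cases hj : j = c
      · subst hj
        rw [setCell_self]
        omega
      · rw [setCell_of_ne _ _ (by omega)]
        constructor
        · omega
        · intro hj'
          have := hcol j hj'.1 hj
          omega
    have a3 : A 1 ⊆ A b := fun j hj => by
      simp only [hA, Finset.mem_filter, Finset.mem_range] at hj ⊢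
      omega
    rw [height, ← Nat.cast_sum, ← Nat.cast_sum, e1, e2, a1, a2,
      Finset.card_sdiff_of_subset a3, Nat.cast_sub (Finset.card_le_card a3)]
  have hv := hht (S t c) (by omega)
  have hcard : (A (S t c)).card = (B (S t c)).card :=
    le_antisymm (Finset.card_le_card hAB) (Finset.card_le_card (hBA _))
  refine ⟨S t c, ⟨fun b hb => ?_, fun b hb => ?_⟩, fun b y => ?_⟩
  · change height (arr n s (setCell S (t + 1) c 0) t)
      (arr n s (setCell S (t + 1) c 0) (t + 1)) _ ≤ height (arr n s (setCell S (t + 1) c 0) t)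
      (arr n s (setCell S (t + 1) c 0) (t + 1)) b
    rw [hv]
    rcases Nat.eq_zero_or_pos b with rfl | hb
    · rw [height_zero, arr_eq_zero (by omega)]
      omega
    · rw [hht b hb]
      have := Finset.card_le_card (hBA b)
      omega
  · change height (arr n s (setCell S (t + 1) c 0) t)
      (arr n s (setCell S (t + 1) c 0) (t + 1)) _ < height (arr n s (setCell S (t + 1) c 0) t)
      (arr n s (setCell S (t + 1) c 0) (t + 1)) b
    rw [hv, hht b (by omega)]
    have := hBA' b hb
    omega
  · have e1 := arr_setCell (n := n) S (x := t + 1) 0 hc y b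
    have e2 := arr_setCell (n := n) S (x := t + 1) (S t c) hc y b
    have e3 := arr_setCell (n := n) (setCell S (t + 1) c (S t c)) (x := t) 0 hc y b
    rw [setCell_of_ne (x := t) _ _ (by omega)] at e3
    simp only [Function.swap]
    split_ifs at e1 e2 e3 ⊢ <;> omega

theorem arr_slide_left {S : ℕ → ℕ → ℕ} {i d : ℕ} (hd : d + 1 < s) :
    arr n s (setCell (setCell S i (d + 1) (S i d)) i d 0) = arr n s (setCell S i (d + 1) 0) := by
  funext y b
  have e1 := arr_setCell (n := n) S (x := i) 0 hd y b
  have e2 := arr_setCell (n := n) S (x := i) (S i d) hd y b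
  have e3 := arr_setCell (n := n) (setCell S i (d + 1) (S i d)) (x := i) 0
    (show d < s by omega) y b
  rw [setCell_of_ne (x := i) (y := d) _ _ (by omega)] at e3
  split_ifs at e1 e2 e3 <;> omega

theorem IsFilling.move_up {S : ℕ → ℕ → ℕ} {t c : ℕ} (ht : t + 1 < r) (hc : c < s)
    (h : IsFilling n r s (fun x j => x = t + 1 ∧ j = c) S z c₀) (h0 : S t c ≠ 0)
    (hle : leftOf S (t + 1) c ≤ S t c) :
    IsFilling n r s (fun x j => x = t ∧ j = c) (setCell S (t + 1) c (S t c)) z c₀ := by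
  have hvn : S t c < n := by
    have := h.bound t c (by omega) hc (by omega)
    omega
  have hleft : ∀ j < c, S (t + 1) j ≤ S t c := fun j hj => by
    have e : leftOf S (t + 1) c = S (t + 1) (c - 1) := if_neg (by omega)
    rw [e] at hle
    rcases (show j < c - 1 ∨ j = c - 1 by omega) with h1 | rfl
    · exact (h.row (t + 1) j (c - 1) ht h1 (by omega) (by omega) (by omega)).trans hle
    · exact hle
  refine ⟨fun x j j' hx hj hj' h1 h2 => ?_, fun x x' j hx hx' hj h1 h2 => ?_,
    fun x j hx hj h1 => ?_, fun x j hx hj h1 => ?_⟩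
  · unfold setCell
    split_ifs with p q q
    · omega
    · obtain ⟨rfl, rfl⟩ := p
      have := h.row t j j' (by omega) hj hj' (by omega) (by omega)
      have := h.col t (t + 1) j' (by omega) hx (by omega) (by omega) (by omega)
      omega
    · obtain ⟨rfl, rfl⟩ := q
      exact hleft j hj
    · exact h.row x j j' hx hj hj' p q
  · unfold setCell
    split_ifs with p q q
    · omega
    · obtain ⟨rfl, rfl⟩ := p
      exact h.col t x' j (by omega) hx' hj (by omega) (by omega)
    · obtain ⟨rfl, rfl⟩ := q
      exact h.col x t j (by omega) (by omega) hj (by omega) (by omega)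
    · exact h.col x x' j hx hx' hj p q
  · unfold setCell
    split_ifs with p
    · simp only [h0, false_iff]; omega
    · exact h.zero x j hx hj p
  · unfold setCell
    split_ifs with p
    · exact Or.inl hvn
    · exact h.bound x j hx hj p

theorem IsFilling.move_left {S : ℕ → ℕ → ℕ} {i d : ℕ} (hi : i < r) (hd : d + 1 < s)
    (h : IsFilling n r s (fun x j => x = i ∧ j = d + 1) S z c₀) (hz : z ≤ d + 1) (hd₀ : d < c₀)
    (hlt : above S i (d + 1) < S i d) :
    IsFilling n r s (fun x j => x = i ∧ j = d) (setCell S i (d + 1) (S i d)) z c₀ := by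
  refine ⟨fun x j j' hx hj hj' h1 h2 => ?_, fun x x' j hx hx' hj h1 h2 => ?_,
    fun x j hx hj h1 => ?_, fun x j hx hj h1 => ?_⟩
  · unfold setCell
    split_ifs with p q q
    · omega
    · obtain ⟨rfl, rfl⟩ := p
      exact h.row x d j' hx (by omega) hj' (by omega) (by omega)
    · obtain ⟨rfl, rfl⟩ := q
      exact h.row x j d hx (by omega) (by omega) (by omega) (by omega)
    · exact h.row x j j' hx hj hj' p q
  · unfold setCell
    split_ifs with p q q
    · omega
    · obtain ⟨rfl, rfl⟩ := p
      have := h.col x x' d hx hx' (by omega) (by omega) (by omega)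
      have := h.row x' d (d + 1) hx' (by omega) hj (by omega) (by omega)
      omega
    · obtain ⟨rfl, rfl⟩ := q
      rw [above, if_neg (by omega)] at hlt
      rcases (show x = x' - 1 ∨ x < x' - 1 by omega) with rfl | h3
      · exact hlt
      · exact (h.col x (x' - 1) (d + 1) h3 (by omega) hj (by omega) (by omega)).trans hlt
    · exact h.col x x' j hx hx' hj p q
  · unfold setCell
    split_ifs with p
    · constructor
      · omega
      · omega
    · exact h.zero x j hx hj p
  · unfold setCell
    split_ifs with p
    · have := h.bound i d hi (by omega) (by omega)
      omega
    · exact h.bound x j hx hj p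

theorem range_succ_reverse (t : ℕ) :
    (List.range (t + 1)).reverse = t :: (List.range t).reverse := by
  rw [List.range_succ, List.reverse_append]; rfl

/-- The slide into a hole acts on the array by the row operators of all rows above; its result is a
filling without hole with one more entry `0`, and its path is a barrier for the next slide. -/
theorem slide_spec (hn : 0 < n) (S : ℕ → ℕ → ℕ) (i c : ℕ) : ∀ E : ℕ → ℕ, i < r → c < s → c < c₀ →
    IsFilling n r s (fun x j => x = i ∧ j = c) S z c₀ → IsBarrier s S z i E → E i ≤ c →
    IsFilling n r s (fun _ _ => False) (slide S i c) (z + 1) c₀ ∧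
    RowSteps (List.range i).reverse (arr n s (setCell S i c 0)) (arr n s (slide S i c)) ∧
    (∀ x j, i < x ∨ (x = i ∧ c < j) → slide S i c x j = S x j) ∧
    ∃ E', IsBarrier s (slide S i c) (z + 1) i E' ∧ E' i ≤ c + 1 := by
  induction S, i, c using slide.induct with
  | case1 S i c h =>
    intro E hi hc hc₀ hS hE hEi
    have hz := hE.zero_le i le_rfl
    obtain rfl : i = 0 := by
      by_contra hi0
      have h1 := h.1
      rw [above, if_neg hi0, hS.zero _ _ (by omega) hc (by omega)] at h1
      omega
    obtain rfl : c = z := by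
      by_contra hcz
      have h1 := h.2
      rw [leftOf, if_neg (by omega), hS.zero _ _ hi (by omega) (by omega)] at h1
      omega
    rw [slide, dif_pos h]
    refine ⟨⟨fun x j j' hx hj hj' _ _ => ?_, fun x x' j hx hx' hj _ _ => ?_,
      fun x j hx hj _ => ?_, fun x j hx hj _ => ?_⟩, rfl,
      fun x j hx => setCell_of_ne _ _ (by omega), fun _ => c + 1, ⟨rfl, by simp, by simp⟩, le_rfl⟩
    · unfold setCell
      split_ifs with p q q
      · exact le_rfl
      · exact Nat.zero_le _
      · obtain ⟨rfl, rfl⟩ := q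
        exact ((hS.zero 0 j hx (by omega) p).2 ⟨rfl, hj⟩).le
      · exact hS.row x j j' hx hj hj' p q
    · unfold setCell
      split_ifs with p q q
      · omega
      · have := hS.zero x' j hx' hj q
        omega
      · omega
      · exact hS.col x x' j hx hx' hj p q
    · unfold setCell
      split_ifs with p
      · simp only [true_iff]; omega
      · rw [hS.zero x j hx hj p]; omega
    · unfold setCell
      split_ifs with p
      · exact Or.inl hn
      · exact hS.bound x j hx hj p
  | case2 S i c h hle ih =>
    intro E hi hc hc₀ hS hE hEi
    have ha : above S i c ≠ 0 := by omega
    obtain ⟨t, rfl⟩ : ∃ t, i = t + 1 := by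
      refine ⟨i - 1, ?_⟩
      have : i ≠ 0 := by
        rintro rfl
        exact ha (if_pos rfl)
      omega
    have hab : above S (t + 1) c = S t c := if_neg (by omega)
    rw [slide, dif_neg h, if_pos hle]
    rw [hab] at ha hle ih ⊢
    rw [Nat.add_sub_cancel] at ih ⊢
    obtain ⟨h1, h2, h3, E', h4, h5⟩ := ih E (by omega) hc hc₀ (hS.move_up hi hc ha hle)
      ⟨hE.zero, fun x hx => hE.mono x (by omega), fun x hx hs => by
        have := hE.le x (by omega) hs
        unfold leftOf at this ⊢
        rwa [setCell_of_ne _ _ (by omega), setCell_of_ne _ _ (by omega)]⟩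
      ((hE.mono t (by omega)).trans hEi)
    refine ⟨h1, ?_, fun x j hx => ?_, fun x => if x = t + 1 then c + 1 else E' x, ⟨?_, ?_, ?_⟩, ?_⟩
    · rw [range_succ_reverse]
      exact ⟨_, rowStep_of_hole hi hc hS ha hle, h2⟩
    · rw [h3 x j (by omega), setCell_of_ne _ _ (by omega)]
    · rw [if_neg (by omega), h4.zero]
    · intro x hx
      rcases (show x = t ∨ x < t by omega) with rfl | hx
      · rw [if_neg (by omega), if_pos rfl]; exact h5
      · rw [if_neg (by omega), if_neg (by omega)]; exact h4.mono x hx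
    · intro x hx hs
      rcases (show x = t ∨ x < t by omega) with rfl | hx
      · rw [if_pos rfl] at hs ⊢
        rw [leftOf, if_neg (by omega), Nat.add_sub_cancel, h3 _ _ (by omega), setCell_self,
          h3 _ _ (by omega), setCell_of_ne _ _ (by omega)]
        exact hS.row x c (c + 1) (by omega) (by omega) hs (by omega) (by omega)
      · rw [if_neg (by omega)] at hs ⊢
        exact h4.le x hx hs
    · exact (if_pos rfl).le
  | case3 S i c h hle ih =>
    intro E hi hc hc₀ hS hE hEi
    obtain ⟨d, rfl⟩ : ∃ d, c = d + 1 := by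
      refine ⟨c - 1, ?_⟩
      have : c ≠ 0 := by
        rintro rfl
        exact hle ((if_pos rfl : leftOf S i 0 = 0).le.trans (Nat.zero_le _))
      omega
    have hl : leftOf S i (d + 1) = S i d := if_neg (by omega)
    rw [slide, dif_neg h, if_neg hle]
    rw [not_le] at hle
    rw [hl] at ih hle ⊢
    rw [Nat.add_sub_cancel] at ih ⊢
    have hz := hE.zero_le i le_rfl
    have hEd : E i ≤ d := by
      by_contra hEd
      have hEd : E i = d + 1 := by omega
      cases i with
      | zero =>
        have := (hS.zero 0 d hi (by omega) (by omega)).2 ⟨rfl, by rw [← hE.zero]; omega⟩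
        omega
      | succ t =>
        have := hE.le t (by omega) (by omega)
        rw [hEd, hl] at this
        rw [above, if_neg (by omega), Nat.add_sub_cancel] at hle
        omega
    obtain ⟨h1, h2, h3, E', h4, h5⟩ := ih E hi (by omega) (by omega)
      (hS.move_left hi hc (by omega) (by omega) hle)
      ⟨hE.zero, hE.mono, fun x hx hs => by
        have := hE.le x hx hs
        have hx' : x + 1 = i → E (x + 1) ≤ d := by rintro rfl; exact hEd
        unfold leftOf at this ⊢
        rwa [setCell_of_ne _ _ (by omega), setCell_of_ne _ _ (by omega)]⟩ hEd
    refine ⟨h1, ?_, fun x j hx => ?_, E', h4, by omega⟩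
    · rwa [arr_slide_left hc] at h2
    · rw [h3 x j (by omega), setCell_of_ne _ _ (by omega)]

end Slide

/-! ### Promotion as a sequence of row operators -/

/-- The row operators which carry out `z` slides into the bottom row of a tableau with `r` rows. -/
def slideRows (r z : ℕ) : List ℕ := (List.replicate z (List.range (r - 1)).reverse).flatten

theorem slideRows_succ (r z : ℕ) :
    slideRows r (z + 1) = slideRows r z ++ (List.range (r - 1)).reverse := by
  simp [slideRows, List.replicate_succ']

theorem lt_of_mem_slideRows {r z t : ℕ} (h : t ∈ slideRows r z) : t + 1 < r := by
  simp only [slideRows, List.mem_flatten, List.mem_replicate] at h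
  obtain ⟨l, ⟨-, rfl⟩, h⟩ := h
  simp only [List.mem_reverse, List.mem_range] at h
  omega

namespace SST

variable {n r s : ℕ}

theorem isFilling (T : SST n r s) : IsFilling n r s (fun _ _ => False) T.fill 0 0 := by
  refine ⟨fun x j j' hx hj hj' _ _ => T.fill_row_le hx hj.le hj',
    fun x x' j hx hx' hj _ _ => T.fill_col_lt hx hx' hj, fun x j hx hj _ => ?_,
    fun x j hx hj _ => ?_⟩
  · have := T.one_le_fill hx hj
    omega
  · have := T.fill_add_le hj (r - 1 - x) (i := x) (by omega)
    omega

/-- The state of promotion when the cells of the bottom row in the columns `< j` have been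
treated. -/
theorem foldl_slide_spec (hr : 1 ≤ r) (hrn : r < n) (T : SST n r s) {j : ℕ} (hj : j ≤ s) :
    let P := (List.range j).foldl
      (fun S c => if T.fill (r - 1) c = n then slide S (r - 1) c else S) T.fill
    let z := ((Finset.range j).filter fun c => T.fill (r - 1) c = n).card
    IsFilling n r s (fun _ _ => False) P z j ∧
    RowSteps (slideRows r z) (arr n s T.fill) (arr n s P) ∧
    (∀ x c, r ≤ x ∨ (x = r - 1 ∧ j ≤ c) → P x c = T.fill x c) ∧
    ∃ E, IsBarrier s P z (r - 1) E ∧ E (r - 1) ≤ j := by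
  induction j with
  | zero =>
    refine ⟨by simpa using T.isFilling, rfl, fun _ _ _ => rfl, fun _ => 0, ⟨rfl, by simp, ?_⟩,
      le_rfl⟩
    intro x _ _
    exact Nat.zero_le _
  | succ j ih =>
    obtain ⟨h1, h2, h3, E, h4, h5⟩ := ih (by omega)
    simp only [List.range_succ, List.foldl_append, List.foldl_cons, List.foldl_nil,
      Finset.range_add_one, Finset.filter_insert]
    set P := (List.range j).foldl
      (fun S c => if T.fill (r - 1) c = n then slide S (r - 1) c else S) T.fill
    have hPj : P (r - 1) j = T.fill (r - 1) j := h3 _ _ (by omega)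
    split_ifs with hT
    · rw [Finset.card_insert_of_notMem (by simp)]
      have hH : IsFilling n r s (fun x c => x = r - 1 ∧ c = j) P _ (j + 1) :=
        ⟨fun x c c' hx hc hc' _ _ => h1.row x c c' hx hc hc' id id,
          fun x x' c hx hx' hc _ _ => h1.col x x' c hx hx' hc id id,
          fun x c hx hc _ => h1.zero x c hx hc id, fun x c hx hc hxc => by
            have := h1.bound x c hx hc id
            omega⟩
      obtain ⟨g1, g2, g3, E', g4, g5⟩ := slide_spec (by omega) P (r - 1) j E (by omega) (by omega)
        (by omega) hH h4 h5
      refine ⟨g1, ?_, fun x c hx => ?_, E', g4, g5⟩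
      · rw [slideRows_succ]
        refine h2.append ?_
        have e : arr n s (setCell P (r - 1) j 0) = arr n s P := by
          funext y a
          have := arr_setCell (n := n) P (x := r - 1) 0 (show j < s by omega) y a
          rw [hPj, hT] at this
          split_ifs at this <;> omega
        rwa [e] at g2
      · rw [g3 x c (by omega), h3 x c (by omega)]
    · refine ⟨⟨h1.row, h1.col, h1.zero, fun x c hx hc hH => ?_⟩, h2,
        fun x c hx => h3 x c (by omega), E, h4, by omega⟩
      have := h1.bound x c hx hc id
      have e : x = r - 1 → c = j → P x c ≠ n := by
        rintro rfl rfl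
        rw [hPj]; exact hT
      omega

theorem mult_top (hr : 1 ≤ r) (hrn : r < n) (T : SST n r s) :
    T.mult n = ((Finset.range s).filter fun c => T.fill (r - 1) c = n).card := by
  rw [mult_eq, Finset.sum_eq_single (r - 1)]
  · exact arr_eq_card (by omega) (by omega)
  · intro x hx hxr
    rw [Finset.mem_range] at hx
    by_contra h
    obtain ⟨-, -, j, hj, h2⟩ := array_pos.1 (Nat.pos_of_ne_zero h)
    have := T.fill_add_le hj (r - 1 - x) (i := x) (by omega)
    omega
  · intro h
    simp only [Finset.mem_range] at h
    omega

/-- Promotion yields a tableau.  Without its letters `1`, and with the remaining letters decreased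
by `1`, its array arises by row operators from that of the original tableau without its
letters `n`. -/
theorem exists_promotion (hr : 1 ≤ r) (hrn : r < n) (T : SST n r s) :
    ∃ U : SST n r s, U.fill = promotion n r s T.fill ∧
      (∃ M, RowSteps (slideRows r (T.mult n)) (arr n s T.fill) M ∧
        ∀ x a, 1 ≤ a → U.array x (a + 1) = M x a) ∧
      ∀ x, U.array x 1 = if x = 0 then T.mult n else 0 := by
  obtain ⟨h1, h2, h3, -⟩ := foldl_slide_spec hr hrn T le_rfl
  rw [← mult_top hr hrn] at h1 h2
  set P := (List.range s).foldl
    (fun S c => if T.fill (r - 1) c = n then slide S (r - 1) c else S) T.fill with hP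
  have hprom : promotion n r s T.fill = fun i j => if i < r ∧ j < s then P i j + 1 else 0 := rfl
  have hb : ∀ x j, x < r → j < s → P x j < n := fun x j hx hj => by
    have := h1.bound x j hx hj id
    omega
  obtain ⟨U, hU⟩ := exists_fill_eq (n := n) (r := r) (s := s) (S := promotion n r s T.fill)
    (fun i j hi hj => by rw [hprom]; simp only [hi, hj, and_self, if_true]; omega)
    (fun i j hi hj => by
      have := hb i j hi hj
      rw [hprom]; simp only [hi, hj, and_self, if_true]; omega)
    (fun i j h => if_neg h)
    (fun i j hi hj => by
      have := h1.row i j (j + 1) hi (by omega) hj id id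
      rw [hprom]
      simp only [hi, hj, show j < s by omega, and_self, if_true]; omega)
    (fun i j hi hj => by
      have := h1.col i (i + 1) j (by omega) hi hj id id
      rw [hprom]
      simp only [hi, hj, show i < r by omega, and_self, if_true]; omega)
  have hUP : ∀ i j, i < r → j < s → U.fill i j = P i j + 1 := fun i j hi hj => by
    rw [hU]; exact if_pos ⟨hi, hj⟩
  refine ⟨U, hU, ⟨_, h2, fun x a ha => ?_⟩, fun x => ?_⟩
  · by_cases hx : x < r
    · by_cases han : a < n
      · rw [array, arr_eq_card (by omega) (by omega), arr_eq_card ha han]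
        congr 1
        refine Finset.filter_congr fun j hj => ?_
        rw [hUP x j hx (Finset.mem_range.1 hj)]
        omega
      · rw [U.array_of_not_mem (by omega), arr_eq_zero (by omega)]
    · rw [U.array_of_row_ge (by omega), eq_comm]
      by_contra h
      obtain ⟨-, -, j, -, h4⟩ := arr_pos.1 (Nat.pos_of_ne_zero h)
      rw [h3 x j (by omega), T.fill_eq_zero (by omega)] at h4
      omega
  · by_cases hx : x < r
    · have hz : T.mult n ≤ s := by
        rw [mult_top hr hrn]
        exact (Finset.card_filter_le _ _).trans (Finset.card_range s).le
      rw [array, arr_eq_card le_rfl (by omega)]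
      have e : ((Finset.range s).filter fun j => U.fill x j = 1) =
          if x = 0 then Finset.range (T.mult n) else ∅ := by
        ext j
        rw [apply_ite (j ∈ ·)]
        simp only [Finset.mem_filter, Finset.mem_range, Finset.notMem_empty]
        constructor
        · rintro ⟨hj, hj'⟩
          rw [hUP x j hx hj] at hj'
          have := (h1.zero x j hx hj id).1 (by omega)
          rw [if_pos this.1]; exact this.2
        · intro hj
          split_ifs at hj with hx0
          have := (h1.zero x j hx (by omega) id).2 ⟨hx0, hj⟩
          exact ⟨by omega, by rw [hUP x j hx (by omega)]; omega⟩
      rw [e, apply_ite Finset.card, Finset.card_range, Finset.card_empty]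
    · rw [U.array_of_row_ge (by omega), if_neg (by omega)]

/-- Promotion on tableaux, for `1 ≤ r < n` (and the identity otherwise). -/
noncomputable def pr (T : SST n r s) : SST n r s :=
  if h : 1 ≤ r ∧ r < n then (exists_promotion h.1 h.2 T).choose else T

theorem pr_spec (hr : 1 ≤ r) (hrn : r < n) (T : SST n r s) : T.pr.fill = promotion n r s T.fill ∧
      (∃ M, RowSteps (slideRows r (T.mult n)) (arr n s T.fill) M ∧
        ∀ x a, 1 ≤ a → T.pr.array x (a + 1) = M x a) ∧
      ∀ x, T.pr.array x 1 = if x = 0 then T.mult n else 0 := by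
  unfold pr
  rw [dif_pos ⟨hr, hrn⟩]
  exact (exists_promotion hr hrn T).choose_spec

theorem arr_fill (T : SST n r s) (x a : ℕ) :
    arr n s T.fill x a = if a < n then T.array x a else 0 := by
  unfold array arr
  split_ifs <;> first | rfl | omega

/-- Promotion intertwines `f̃_i` and `f̃_{i+1}`, since letter operators commute with row
operators. -/
theorem FStep.pr (hr : 1 ≤ r) (hrn : r < n) {i : ℕ} (hi : 1 ≤ i) (hin : i + 1 < n)
    {T T' : SST n r s} (h : FStep i T T') : FStep (i + 1) T.pr T'.pr := by
  obtain ⟨-, ⟨M, hM, hM'⟩, h1⟩ := pr_spec hr hrn T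
  obtain ⟨-, ⟨N, hN, hN'⟩, h1'⟩ := pr_spec hr hrn T'
  have hz : T'.mult n = T.mult n := by
    have := h.mult n
    split_ifs at this <;> omega
  rw [hz] at hN h1'
  have h0 : LetterStep i (arr n s T.fill) (arr n s T'.fill) := by
    obtain ⟨x, hx, hN⟩ := h
    refine ⟨x, ?_, fun y a => ?_⟩
    · rwa [height_congr (fun y => (arr_fill T y i).trans (if_pos (by omega)))
        (fun y => (arr_fill T y (i + 1)).trans (if_pos hin))]
    · have := hN y a
      rw [arr_fill, arr_fill]
      split_ifs at this ⊢ <;> omega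
  obtain ⟨x, hx, hMN⟩ := h0.rowSteps hM hN
  refine ⟨x, ?_, fun y a => ?_⟩
  · rwa [height_congr (fun y => hM' y i hi) (fun y => hM' y (i + 1) (by omega))]
  · rcases a with _ | _ | a
    · rw [array_of_not_mem _ (by omega), array_of_not_mem _ (by omega)]
      split_ifs <;> omega
    · rw [zero_add, h1, h1']
      split_ifs <;> omega
    · have := hMN y (a + 1)
      rw [hM' y (a + 1) (by omega), hN' y (a + 1) (by omega)]
      split_ifs at this ⊢ <;> omega

theorem exists_fStep_of_pr (hr : 1 ≤ r) (hrn : r < n) {i : ℕ} (hi : 1 ≤ i) (hin : i + 1 < n)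
    {T U : SST n r s} (h : FStep (i + 1) T.pr U) : ∃ T', FStep i T T' := by
  obtain ⟨-, ⟨M, hM, hM'⟩, -⟩ := pr_spec hr hrn T
  obtain ⟨x, hx, -⟩ := h
  rw [height_congr (fun y => hM' y i hi) (fun y => hM' y (i + 1) (by omega))] at hx
  obtain ⟨x, hx⟩ := hM.exists_isLastMin ⟨x, hx⟩
  rw [height_congr (fun y => (arr_fill T y i).trans (if_pos (by omega)))
        (fun y => (arr_fill T y (i + 1)).trans (if_pos hin))] at hx
  exact exists_fStep hi (by omega) T hx

theorem pr_mult_succ (hr : 1 ≤ r) (hrn : r < n) (T : SST n r s) {a : ℕ} (ha : 1 ≤ a) (han : a < n) :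
    T.pr.mult (a + 1) = T.mult a := by
  obtain ⟨-, ⟨M, hM, hM'⟩, -⟩ := pr_spec hr hrn T
  rw [mult_eq, mult_eq, Finset.sum_congr rfl fun x _ => hM' x a ha,
    hM.sum_eq a fun t ht => lt_of_mem_slideRows ht]
  exact Finset.sum_congr rfl fun x _ => (arr_fill T x a).trans (if_pos han)

theorem pr_mult_one (hr : 1 ≤ r) (hrn : r < n) (T : SST n r s) : T.pr.mult 1 = T.mult n := by
  obtain ⟨-, -, h⟩ := pr_spec hr hrn T
  rw [mult_eq, Finset.sum_congr rfl fun x _ => h x]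
  simp
  omega

end SST
/-! ### Existence of crystal operators -/

theorem exists_isLastMin {h : ℕ → ℤ} {r x : ℕ} (hx : ∀ z, r ≤ z → h x < h z) :
    ∃ x, IsLastMin h x := by
  have hxr : x < r := by
    by_contra hxr
    exact lt_irrefl _ (hx x (by omega))
  obtain ⟨y, hy, hmin⟩ := Finset.exists_min_image (Finset.range r) h ⟨x, Finset.mem_range.2 hxr⟩
  obtain ⟨w, hw, hmax⟩ := Finset.exists_max_image ((Finset.range r).filter fun w => h w = h y) id
    ⟨y, by simpa using hy⟩
  simp only [Finset.mem_filter, Finset.mem_range, id] at hw hmax hmin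
  refine ⟨w, fun z hz => ?_, fun z hz => ?_⟩
  · rw [hw.2]
    exact hmin z (by omega)
  · rw [hw.2]
    by_cases hzr : z < r
    · refine lt_of_le_of_ne (hmin z hzr) fun e => ?_
      have := hmax z ⟨hzr, e.symm⟩
      omega
    · exact (hmin x hxr).trans_lt (hx z (by omega))

/-- A row operator does not create negative heights: if `ẽ_i` is defined after it, it was defined
before. -/
theorem RowStep.exists_neg {i t : ℕ} {M M' : ℕ → ℕ → ℕ} (hM : RowStep t M M')
    (hx : ∃ x, height (fun y => M' y i) (fun y => M' y (i + 1)) x < 0) :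
    ∃ x, height (fun y => M y i) (fun y => M y (i + 1)) x < 0 := by
  obtain ⟨x, hx⟩ := hx
  obtain ⟨a, ha, hMM⟩ := hM
  have hD : height (fun y => M' y i) (fun y => M' y (i + 1)) x =
    height (fun y => M y i) (fun y => M y (i + 1)) x - _ + _ := height_row_of_move hMM i x
  have hcr := height_cross M t i
  change IsLastMin (height (M t) (M (t + 1))) a at ha
  by_cases hs : a = i ∧ x = t + 1
  · obtain ⟨rfl, rfl⟩ := hs
    have := ha.2 (a + 1) (by omega)
    refine ⟨t, ?_⟩
    split_ifs at hD <;> omega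
  · refine ⟨x, ?_⟩
    split_ifs at hD <;> omega

theorem RowSteps.exists_neg {i : ℕ} : ∀ {l : List ℕ} {M M' : ℕ → ℕ → ℕ}, RowSteps l M M' →
    (∃ x, height (fun y => M' y i) (fun y => M' y (i + 1)) x < 0) →
    ∃ x, height (fun y => M y i) (fun y => M y (i + 1)) x < 0
  | [], _, _, h, h' => by
    obtain rfl : _ = _ := h
    exact h'
  | _ :: _, _, _, ⟨_, h₁, h⟩, h' => h₁.exists_neg (h.exists_neg h')

namespace SST

variable {n r s : ℕ}

theorem ht_le_of_ge (T : SST n r s) (i : ℕ) {x : ℕ} (hx : r ≤ x + 1) (d : ℕ) :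
    T.ht i x ≤ T.ht i (x + d) := by
  induction d with
  | zero => exact le_rfl
  | succ d ih =>
    have h2 := height_succ_sub (fun y => T.array y i) (fun y => T.array y (i + 1)) (x + d)
    rw [T.array_of_row_ge (show r ≤ x + d + 1 by omega)] at h2
    change T.ht i (x + d + 1) - T.ht i (x + d) = _ at h2
    rw [← add_assoc]
    omega

theorem exists_fStep_left {i : ℕ} (hi : 1 ≤ i) (hin : i < n) (T : SST n r s)
    (hx : ∃ x, T.ht i x < 0) : ∃ T', FStep i T' T := by
  obtain ⟨x, hxr, hx⟩ : ∃ x < r, T.ht i x < 0 := by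
    obtain ⟨x, hx⟩ := hx
    by_cases hxr : x < r
    · exact ⟨x, hxr, hx⟩
    · have hr : r ≠ 0 := by
        rintro rfl
        have := T.ht_le_of_ge i (x := 0) (by omega) x
        rw [zero_add, ht, height_zero, T.array_of_row_ge le_rfl] at this
        rw [ht] at hx
        omega
      have := T.ht_le_of_ge i (x := r - 1) (by omega) (x - (r - 1))
      rw [show r - 1 + (x - (r - 1)) = x by omega] at this
      exact ⟨r - 1, by omega, by omega⟩
  have hH := height_reverse (p := fun y => T.array y i) (q := fun y => T.array y (i + 1))
    (p' := fun y => T.rot.array y (n - i)) (q' := fun y => T.rot.array y (n - i + 1)) (r := r)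
    (fun y hy => by rw [rot_array _ hy]; congr 1; omega)
    (fun y hy => by rw [rot_array _ hy]; congr 1; omega)
    (fun y hy => array_of_row_ge _ hy _) (fun y hy => array_of_row_ge _ hy _)
  obtain ⟨y, hy⟩ := exists_isLastMin (h := T.rot.ht (n - i)) (r := r) (x := r - 1 - x)
    fun z hz => by
      rw [ht, hH, hH, if_pos (by omega), if_neg (by omega), show r - 1 - (r - 1 - x) = x by omega]
      rw [ht] at hx
      omega
  obtain ⟨U, hU⟩ := exists_fStep (by omega) (by omega) _ hy
  have := hU.rot (by omega) (by omega)
  rw [rot_rot, show n - (n - i) = i by omega] at this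
  exact ⟨_, this⟩

theorem FStep.exists_neg {i : ℕ} {T T' : SST n r s} (h : FStep i T T') : ∃ x, T'.ht i x < 0 := by
  obtain ⟨x, hx, hN⟩ := h
  refine ⟨x, ?_⟩
  rw [ht, height_letter_of_move hN]
  have h0 := height_zero (fun y => T.array y i) (fun y => T.array y (i + 1))
  have : height (fun y => T.array y i) (fun y => T.array y (i + 1)) x ≤
      height (fun y => T.array y i) (fun y => T.array y (i + 1)) 0 := by
    rcases Nat.eq_zero_or_pos x with rfl | h
    · exact le_rfl
    · exact hx.1 0 h
  split_ifs <;> omega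

theorem exists_fStep_left_of_pr (hr : 1 ≤ r) (hrn : r < n) {i : ℕ} (hi : 1 ≤ i) (hin : i + 1 < n)
    {T U : SST n r s} (h : FStep (i + 1) U T.pr) : ∃ T', FStep i T' T := by
  obtain ⟨-, ⟨M, hM, hM'⟩, -⟩ := pr_spec hr hrn T
  obtain ⟨x, hx⟩ := h.exists_neg
  rw [ht, height_congr (fun y => hM' y i hi) (fun y => hM' y (i + 1) (by omega))] at hx
  obtain ⟨x, hx⟩ := hM.exists_neg ⟨x, hx⟩
  rw [height_congr (fun y => (arr_fill T y i).trans (if_pos (by omega)))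
        (fun y => (arr_fill T y (i + 1)).trans (if_pos hin))] at hx
  exact exists_fStep_left hi (by omega) T ⟨x, hx⟩

/-- Crystal operators of orthogonal nodes commute. -/
theorem FStep.comm {i j : ℕ} (hij : i + 1 < j ∨ j + 1 < i) (hi : 1 ≤ i) (hin : i < n) (hj : 1 ≤ j)
    (hjn : j < n) {T U V : SST n r s} (hU : FStep i T U) (hV : FStep j T V) :
    ∃ W, FStep j U W ∧ FStep i V W := by
  obtain ⟨x, hx, hU⟩ := hU
  obtain ⟨y, hy, hV⟩ := hV
  have e : U.ht j = T.ht j := height_congr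
    (fun z => by have := hU z j; split_ifs at this <;> omega)
    (fun z => by have := hU z (j + 1); split_ifs at this <;> omega)
  have e' : V.ht i = T.ht i := height_congr
    (fun z => by have := hV z i; split_ifs at this <;> omega)
    (fun z => by have := hV z (i + 1); split_ifs at this <;> omega)
  obtain ⟨W, y', hy', hW⟩ := exists_fStep hj hjn U (x := y) (by rw [e]; exact hy)
  obtain ⟨W', x', hx', hW'⟩ := exists_fStep hi hin V (x := x) (by rw [e']; exact hx)
  change IsLastMin (U.ht j) y' at hy'
  change IsLastMin (V.ht i) x' at hx'
  rw [e] at hy'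
  rw [e'] at hx'
  obtain rfl := hy'.unique hy
  obtain rfl := hx'.unique hx
  have : W' = W := array_injective <| funext fun z => funext fun a => by
    have h1 := hU z a
    have h2 := hV z a
    have h3 := hW z a
    have h4 := hW' z a
    split_ifs at h1 h2 h3 h4 <;> omega
  subst this
  exact ⟨W', ⟨_, by change IsLastMin (U.ht j) _; rwa [e], hW⟩,
    ⟨_, by change IsLastMin (V.ht i) _; rwa [e'], hW'⟩⟩

theorem FStep.comm_left {i j : ℕ} (hij : i + 1 < j ∨ j + 1 < i) (hi : 1 ≤ i) (hin : i < n)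
    (hj : 1 ≤ j) (hjn : j < n) {U V W : SST n r s} (hV : FStep j U V) (hW : FStep i V W) :
    ∃ Z, FStep i U Z ∧ FStep j Z W := by
  obtain ⟨x, hx, -⟩ := id hW
  obtain ⟨y, hy, hUV⟩ := id hV
  have e : V.ht i = U.ht i := height_congr
    (fun z => by have := hUV z i; split_ifs at this <;> omega)
    (fun z => by have := hUV z (i + 1); split_ifs at this <;> omega)
  change IsLastMin (V.ht i) x at hx
  obtain ⟨Z, hZ⟩ := exists_fStep hi hin U (x := x) (by rwa [← e])
  obtain ⟨W', h1, h2⟩ := hZ.comm hij hi hin hj hjn hV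
  rw [h2.unique hW] at h1
  exact ⟨Z, hZ, h1⟩

/-! ### Tableaux are determined by their weight and extremality -/

/-- If no `f̃_i` with `i > k` can be applied, then each row contains at most one letter greater than
`k`, and this is the largest letter possible in this row. -/
theorem eq_of_no_fStep {k : ℕ} {T : SST n r s}
    (hT : ∀ i, k < i → i < n → ∀ T', ¬FStep i T T') (d : ℕ) : ∀ {x a : ℕ}, x + d + 1 = r → k < a →
    T.array x a ≠ 0 → a + d = n := by
  induction d using Nat.strong_induction_on with
  | _ d ih =>
    intro x a hx ha h
    obtain ⟨-, h1, j, hj, hja⟩ := array_pos.1 (Nat.pos_of_ne_zero h)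
    have hle := T.fill_add_le hj d (i := x) (by omega)
    by_contra hne
    -- a letter `a + 1` must occur below, to match the letters `a` of row `x`
    obtain ⟨y, hy, hya⟩ : ∃ y, x < y ∧ T.array y (a + 1) ≠ 0 := by
      by_contra! hno
      obtain ⟨w, hw⟩ := exists_isLastMin (h := T.ht a) (r := x + 1) (x := x) fun z hz => by
        induction z, hz using Nat.le_induction with
        | base =>
          have h2 := height_succ_sub (fun y => T.array y a) (fun y => T.array y (a + 1)) x
          rw [hno (x + 1) (by omega)] at h2
          unfold ht
          omega
        | succ z hz ih =>
          have h2 := height_succ_sub (fun y => T.array y a) (fun y => T.array y (a + 1)) z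
          rw [hno (z + 1) (by omega)] at h2
          unfold ht at ih ⊢
          omega
      obtain ⟨U, hU⟩ := exists_fStep h1 (by omega) T hw
      exact hT a ha (by omega) U hU
    have hyr : y < r := by
      by_contra hyr
      exact hya (T.array_of_row_ge (by omega) _)
    have := ih (r - 1 - y) (by omega) (by omega) (by omega) hya
    omega

/-- If no `ẽ_i` with `i < k` can be applied, then row `x` contains no letter `a ≤ k` other than
`x + 1` (rows are counted from `0`). -/
theorem eq_of_no_fStep_left {k : ℕ} (hk : k ≤ n) {T : SST n r s}
    (hT : ∀ i, 1 ≤ i → i < k → ∀ T', ¬FStep i T' T) {x a : ℕ} (ha : a ≤ k)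
    (h : T.array x a ≠ 0) : a = x + 1 := by
  obtain ⟨hxr, h1, -⟩ := array_pos.1 (Nat.pos_of_ne_zero h)
  have := eq_of_no_fStep (k := n - k) (T := T.rot) (fun i h1 h2 U hU => by
      have := hU.rot (by omega) h2
      rw [rot_rot] at this
      exact hT (n - i) (by omega) (by omega) _ this)
    x (x := r - 1 - x) (a := n + 1 - a) (by omega) (by omega) (by
      rwa [rot_array _ (by omega), show r - 1 - (r - 1 - x) = x by omega,
        show n + 1 - (n + 1 - a) = a by omega])
  omega

theorem mult_eq_array {T : SST n r s} {x a : ℕ} (hx : x < r)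
    (h : ∀ y, T.array y a ≠ 0 → y = x) : T.mult a = T.array x a := by
  rw [mult_eq, Finset.sum_eq_single x]
  · intro y _ hy
    by_contra h'
    exact hy (h y h')
  · intro h'
    exact absurd (Finset.mem_range.2 hx) h'

theorem mult_of_not_mem (T : SST n r s) {a : ℕ} (ha : ¬(1 ≤ a ∧ a ≤ n)) : T.mult a = 0 := by
  rw [mult_eq]
  exact Finset.sum_eq_zero fun x _ => T.array_of_not_mem ha x

theorem array_eq_of_no_fStep {k : ℕ} {U V : SST n r s}
    (hU : ∀ i, k < i → i < n → ∀ T', ¬FStep i U T')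
    (hV : ∀ i, k < i → i < n → ∀ T', ¬FStep i V T') {a : ℕ} (ha : k < a)
    (hm : U.mult a = V.mult a) {x : ℕ} (hx : x < r) : U.array x a = V.array x a := by
  have key : ∀ {T : SST n r s}, (∀ i, k < i → i < n → ∀ T', ¬FStep i T T') → ∀ y,
      T.array y a ≠ 0 → a + (r - 1 - y) = n ∧ y < r := fun {T} hT y hy =>
    have hyr := (array_pos.1 (Nat.pos_of_ne_zero hy)).1
    ⟨eq_of_no_fStep hT (r - 1 - y) (by omega) ha hy, hyr⟩
  by_cases hxa : a + (r - 1 - x) = n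
  · rw [mult_eq_array hx fun y hy => by have := key hU y hy; omega,
      mult_eq_array hx fun y hy => by have := key hV y hy; omega] at hm
    exact hm
  · rw [not_not.1 (mt (key hU x) (by omega)), not_not.1 (mt (key hV x) (by omega))]

theorem array_eq_of_no_fStep_left {k : ℕ} (hk : k ≤ n) {U V : SST n r s}
    (hU : ∀ i, 1 ≤ i → i < k → ∀ T', ¬FStep i T' U)
    (hV : ∀ i, 1 ≤ i → i < k → ∀ T', ¬FStep i T' V) {a : ℕ} (ha : a ≤ k)
    (hm : U.mult a = V.mult a) {x : ℕ} (hx : x < r) : U.array x a = V.array x a := by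
  by_cases hxa : a = x + 1
  · rw [mult_eq_array hx fun y hy => by have := eq_of_no_fStep_left hk hU ha hy; omega,
      mult_eq_array hx fun y hy => by have := eq_of_no_fStep_left hk hV ha hy; omega] at hm
    exact hm
  · rw [not_not.1 (mt (eq_of_no_fStep_left hk hU ha) hxa),
      not_not.1 (mt (eq_of_no_fStep_left hk hV ha) hxa)]

/-- Tableaux that are extremal for the letters less than `k` and for those greater than `k` are
determined by their weight; the letters `k` fill up the rows. -/
theorem eq_of_extremal {k : ℕ} (hk : k ≤ n) {U V : SST n r s}
    (hU : ∀ i, 1 ≤ i → i + 1 < k → ∀ T', ¬FStep i T' U)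
    (hV : ∀ i, 1 ≤ i → i + 1 < k → ∀ T', ¬FStep i T' V)
    (hU' : ∀ i, k < i → i < n → ∀ T', ¬FStep i U T')
    (hV' : ∀ i, k < i → i < n → ∀ T', ¬FStep i V T') (hm : ∀ a, U.mult a = V.mult a) : U = V := by
  apply array_injective
  funext x a
  by_cases hx : x < r
  · have hne : ∀ a, a ≠ k → U.array x a = V.array x a := fun a ha => by
      rcases lt_or_gt_of_ne ha with h | h
      · exact array_eq_of_no_fStep_left (k := k - 1) (by omega) (fun i h1 h2 => hU i h1 (by omega))
          (fun i h1 h2 => hV i h1 (by omega)) (by omega) (hm a) hx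
      · exact array_eq_of_no_fStep hU' hV' h (hm a) hx
    by_cases ha : a = k
    · subst ha
      have h1 := (U.sum_array hx).trans (V.sum_array hx).symm
      have hmem : a ∈ Finset.range (n + 1) := Finset.mem_range.2 (by omega)
      have h2 : ∑ b ∈ (Finset.range (n + 1)).erase a, U.array x b =
          ∑ b ∈ (Finset.range (n + 1)).erase a, V.array x b :=
        Finset.sum_congr rfl fun b hb => hne b (Finset.ne_of_mem_erase hb)
      rw [← Finset.add_sum_erase _ _ hmem, ← Finset.add_sum_erase _ _ hmem, h2] at h1
      omega
    · exact hne a ha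
  · rw [U.array_of_row_ge (by omega), V.array_of_row_ge (by omega)]

/-- The total of a statistic `g` of letters. -/
def potential (g : ℕ → ℕ) (T : SST n r s) : ℕ := ∑ a ∈ Finset.range (n + 1), T.mult a * g a

theorem FStep.potential {i : ℕ} (hin : i < n) {T T' : SST n r s} (h : FStep i T T') (g : ℕ → ℕ) :
    T'.potential g + g i = T.potential g + g (i + 1) := by
  have h3 := Finset.sum_congr (rfl : Finset.range (n + 1) = Finset.range (n + 1)) fun a _ =>
    congrArg (· * g a) (h.mult a)
  simp only [add_mul, Finset.sum_add_distrib, ite_mul, one_mul, zero_mul, Finset.sum_ite_eq',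
    Finset.mem_range] at h3
  rwa [if_pos (by omega), if_pos (by omega)] at h3

/-- Multiplicity-freeness of the restriction to the Levi subalgebras: tableaux that cannot be
distinguished by their weight and by crystal operators of the letters `< k` and `> k` are equal.
Here `R` is a relation which is compatible with these operators. -/
theorem eq_of_bisimulation {k : ℕ} (hk : k ≤ n) (R : SST n r s → SST n r s → Prop)
    (symm : ∀ U V, R U V → R V U) (hm : ∀ U V, R U V → ∀ a, U.mult a = V.mult a)
    (he : ∀ i, 1 ≤ i → i + 1 < k → ∀ U V U', R U V → FStep i U' U → ∃ V', FStep i V' V ∧ R U' V')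
    (hf : ∀ i, k < i → i < n → ∀ U V U', R U V → FStep i U U' → ∃ V', FStep i V V' ∧ R U' V')
    {U V : SST n r s} (h : R U V) : U = V := by
  set g : ℕ → ℕ := fun a => if a < k then a else n - a
  induction hN : U.potential g using Nat.strong_induction_on generalizing U V with
  | _ N ih =>
    by_cases h1 : ∃ i, 1 ≤ i ∧ i + 1 < k ∧ ∃ U', FStep i U' U
    · obtain ⟨i, hi, hik, U', hU'⟩ := h1
      obtain ⟨V', hV', hR⟩ := he i hi hik U V U' h hU'
      have hp := hU'.potential (by omega) g
      have e1 : g i = i := if_pos (by omega)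
      have e2 : g (i + 1) = i + 1 := if_pos hik
      obtain rfl := ih _ (by omega) hR rfl
      exact hU'.unique hV'
    by_cases h2 : ∃ i, k < i ∧ i < n ∧ ∃ U', FStep i U U'
    · obtain ⟨i, hi, hik, U', hU'⟩ := h2
      obtain ⟨V', hV', hR⟩ := hf i hi hik U V U' h hU'
      have hp := hU'.potential (by omega) g
      have e1 : g i = n - i := if_neg (by omega)
      have e2 : g (i + 1) = n - (i + 1) := if_neg (by omega)
      obtain rfl := ih _ (by omega) hR rfl
      exact hU'.unique_left hV'
    push Not at h1 h2
    refine eq_of_extremal hk h1 (fun i hi hik V' hV' => ?_) h2 (fun i hi hik V' hV' => ?_)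
      (hm U V h)
    · obtain ⟨U', hU', -⟩ := he i hi hik V U V' (symm _ _ h) hV'
      exact h1 i hi hik U' hU'
    · obtain ⟨U', hU', -⟩ := hf i hi hik V U V' (symm _ _ h) hV'
      exact h2 i hi hik U' hU'

/-! ### Promotion rotates the affine Dynkin diagram -/

theorem pr_injective (hr : 1 ≤ r) (hrn : r < n) :
    Function.Injective (pr : SST n r s → SST n r s) := by
  intro T T' h
  refine eq_of_bisimulation (k := n - 1) (by omega) (fun U V => U.pr = V.pr)
    (fun U V h => h.symm) (fun U V h a => ?_) (fun i hi hin U V U' h hU => ?_)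
    (fun i hi hin => by omega) h
  · by_cases ha : 1 ≤ a ∧ a ≤ n
    · rcases (show a = n ∨ a < n by omega) with rfl | han
      · rw [← pr_mult_one hr hrn, ← pr_mult_one hr hrn, h]
      · rw [← pr_mult_succ hr hrn U ha.1 han, ← pr_mult_succ hr hrn V ha.1 han, h]
    · rw [mult_of_not_mem _ ha, mult_of_not_mem _ ha]
  · have h1 := hU.pr hr hrn hi (by omega)
    have h1' := h1
    rw [h] at h1'
    obtain ⟨V', hV⟩ := exists_fStep_left_of_pr hr hrn hi (by omega) h1'
    exact ⟨V', hV, h1'.unique_left (hV.pr hr hrn hi (by omega))⟩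

theorem pr_bijective (hr : 1 ≤ r) (hrn : r < n) : Function.Bijective (pr : SST n r s → SST n r s) :=
  Finite.injective_iff_bijective.1 (pr_injective hr hrn)

theorem fStep_pr_iff (hr : 1 ≤ r) (hrn : r < n) {i : ℕ} (hi : 1 ≤ i) (hin : i + 1 < n)
    {T T' : SST n r s} : FStep (i + 1) T.pr T'.pr ↔ FStep i T T' := by
  refine ⟨fun h => ?_, FStep.pr hr hrn hi hin⟩
  obtain ⟨U, hU⟩ := exists_fStep_of_pr hr hrn hi hin h
  rwa [← pr_injective hr hrn ((hU.pr hr hrn hi hin).unique h)]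

theorem array_one_eq_zero (T : SST n r s) {x : ℕ} (hx : 0 < x) : T.array x 1 = 0 := by
  by_contra h
  obtain ⟨hxr, -, j, hj, h2⟩ := array_pos.1 (Nat.pos_of_ne_zero h)
  have := T.succ_le_fill hxr hj
  omega

theorem array_two_eq_zero (T : SST n r s) {x : ℕ} (hx : 1 < x) : T.array x 2 = 0 := by
  by_contra h
  obtain ⟨hxr, -, j, hj, h2⟩ := array_pos.1 (Nat.pos_of_ne_zero h)
  have := T.succ_le_fill hxr hj
  omega

theorem array_one_two_le (hn : 2 ≤ n) (T : SST n r s) : T.array 1 2 ≤ T.array 0 1 := by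
  by_cases hr : 1 < r
  · rw [array, arr_eq_card (by omega) (by omega), arr_eq_card (by omega) (by omega)]
    refine Finset.card_le_card fun j hj => ?_
    simp only [Finset.mem_filter, Finset.mem_range] at hj ⊢
    have := T.fill_col_lt (show 0 < 1 by omega) hr hj.1
    have := T.one_le_fill (show 0 < r by omega) hj.1
    omega
  · rw [T.array_of_row_ge (by omega)]
    exact Nat.zero_le _

/-- Two tableaux that are extremal for the letters `≥ 3`, with weights that differ by the simple
root `α₁`, are connected by `f̃₁`: their letters `1, 2` form two-row tableaux of the same shape. -/
theorem fStep_one_of_mult (hr : 1 ≤ r) (hn : 2 ≤ n) {U V : SST n r s}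
    (hU : ∀ i, 2 < i → i < n → ∀ T', ¬FStep i U T') (hV : ∀ i, 2 < i → i < n → ∀ T', ¬FStep i V T')
    (h1 : V.mult 1 + 1 = U.mult 1) (h3 : ∀ a, 2 < a → U.mult a = V.mult a) : FStep 1 U V := by
  have ha : ∀ a, a ≠ 1 → a ≠ 2 → ∀ x, U.array x a = V.array x a := fun a ha1 ha2 x => by
    by_cases ha0 : a = 0
    · rw [U.array_of_not_mem (by omega), V.array_of_not_mem (by omega)]
    · by_cases hx : x < r
      · exact array_eq_of_no_fStep hU hV (by omega) (h3 a (by omega)) hx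
      · rw [U.array_of_row_ge (by omega), V.array_of_row_ge (by omega)]
  have hm : ∀ T : SST n r s, T.mult 1 = T.array 0 1 := fun T =>
    mult_eq_array (by omega) fun y hy => by
      by_contra h
      exact hy (T.array_one_eq_zero (by omega))
  have hsum : ∀ x, U.array x 1 + U.array x 2 = V.array x 1 + V.array x 2 := fun x => by
    by_cases hx : x < r
    · have h1 := (U.sum_array hx).trans (V.sum_array hx).symm
      have hm1 : 1 ∈ Finset.range (n + 1) := Finset.mem_range.2 (by omega)
      have hm2 : 2 ∈ (Finset.range (n + 1)).erase 1 := by simp; omega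
      have h2 : ∑ b ∈ ((Finset.range (n + 1)).erase 1).erase 2, U.array x b =
          ∑ b ∈ ((Finset.range (n + 1)).erase 1).erase 2, V.array x b :=
        Finset.sum_congr rfl fun b hb => ha b
          (Finset.ne_of_mem_erase (Finset.mem_of_mem_erase hb)) (Finset.ne_of_mem_erase hb) x
      rw [← Finset.add_sum_erase _ _ hm1, ← Finset.add_sum_erase _ _ hm1,
        ← Finset.add_sum_erase _ _ hm2, ← Finset.add_sum_erase _ _ hm2, h2] at h1
      omega
    · simp only [U.array_of_row_ge (show r ≤ x by omega), V.array_of_row_ge (show r ≤ x by omega)]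
  have hs0 := hsum 0
  have hs1 := hsum 1
  rw [hm, hm] at h1
  have hle := V.array_one_two_le hn
  have z1 := U.array_one_eq_zero (x := 1) (by omega)
  have z2 := V.array_one_eq_zero (x := 1) (by omega)
  refine ⟨0, ⟨by omega, fun y hy => ?_⟩, fun x a => ?_⟩
  · induction y, hy using Nat.le_induction with
    | base =>
      have := height_succ_sub (fun y => U.array y 1) (fun y => U.array y (1 + 1)) 0
      simp only [Nat.succ_eq_add_one, zero_add, Nat.reduceAdd] at this ⊢
      omega
    | succ y hy ih =>
      have := height_succ_sub (fun y => U.array y 1) (fun y => U.array y (1 + 1)) y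
      rw [U.array_one_eq_zero hy, U.array_two_eq_zero (by omega)] at this
      simp only [Nat.reduceAdd] at ih this ⊢
      omega
  · by_cases ha1 : a = 1
    · subst ha1
      by_cases hx : x = 0
      · subst hx
        simp only [true_and, if_true]
        split_ifs <;> omega
      · rw [U.array_one_eq_zero (by omega), V.array_one_eq_zero (by omega)]
        split_ifs <;> omega
    · by_cases ha2 : a = 2
      · subst ha2
        have := hsum x
        by_cases hx : x = 0
        · subst hx
          split_ifs <;> omega
        · rw [U.array_one_eq_zero (by omega), V.array_one_eq_zero (by omega)] at this
          split_ifs <;> omega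
      · rw [ha a ha1 ha2 x]
        split_ifs <;> omega

theorem pr_pr_mult (hr : 1 ≤ r) (hrn : r < n) (T : SST n r s) :
    T.pr.pr.mult 1 = T.mult (n - 1) ∧
      ∀ a, 2 < a → a ≤ n → T.pr.pr.mult a = T.mult (a - 2) := by
  refine ⟨?_, fun a ha han => ?_⟩
  · rw [pr_mult_one hr hrn]
    have := pr_mult_succ hr hrn T (a := n - 1) (by omega) (by omega)
    rwa [show n - 1 + 1 = n by omega] at this
  · have h1 := pr_mult_succ hr hrn T.pr (a := a - 1) (by omega) (by omega)
    have h2 := pr_mult_succ hr hrn T (a := a - 2) (by omega) (by omega)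
    rw [show a - 1 + 1 = a by omega] at h1
    rw [show a - 2 + 1 = a - 1 by omega] at h2
    rw [h1, h2]

/-- The square of promotion intertwines `f̃_{n-1}` and `f̃₁`.  Both sides commute with the operators
`f̃_j`, `j ≥ 3`, which reduces the claim to tableaux that are extremal for these operators. -/
theorem FStep.pr_pr (hr : 1 ≤ r) (hrn : r < n) {T T' : SST n r s} (h : FStep (n - 1) T T') :
    FStep 1 T.pr.pr T'.pr.pr := by
  induction hN : T.pr.pr.potential (fun a => n - a) using Nat.strong_induction_on
    generalizing T T' with
  | _ N ih =>
    have h2 : ∀ {i : ℕ} {T T' : SST n r s}, 1 ≤ i → i + 2 < n →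
        (FStep (i + 2) T.pr.pr T'.pr.pr ↔ FStep i T T') := fun hi hin =>
      (fStep_pr_iff hr hrn (by omega) (by omega)).trans (fStep_pr_iff hr hrn (by omega) (by omega))
    by_cases hex : ∃ j, 2 < j ∧ j < n ∧ ∃ V, FStep j T.pr.pr V
    · obtain ⟨j, hj, hjn, V, hV⟩ := hex
      obtain ⟨i, rfl⟩ : ∃ i, j = i + 2 := ⟨j - 2, by omega⟩
      obtain ⟨V₁, rfl⟩ := (pr_bijective hr hrn).2 V
      obtain ⟨T₂, rfl⟩ := (pr_bijective hr hrn).2 V₁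
      obtain ⟨T₃, h3, h4⟩ := h.comm (by omega) (by omega) (by omega) (by omega) (by omega)
        ((h2 (by omega) hjn).1 hV)
      have hp := hV.potential hjn fun a => n - a
      have h5 := ih _ (by omega) h4 rfl
      obtain ⟨Z, hZ, hZ'⟩ := FStep.comm_left (i := 1) (by omega) (by omega) (by omega) (by omega)
        hjn hV h5
      rwa [← hZ'.unique_left ((h2 (by omega) hjn).2 h3)]
    · push Not at hex
      obtain ⟨m1, m3⟩ := pr_pr_mult hr hrn T
      obtain ⟨m1', m3'⟩ := pr_pr_mult hr hrn T'
      refine fStep_one_of_mult hr (by omega) hex (fun j hj hjn V hV => ?_) ?_ fun a ha => ?_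
      · obtain ⟨i, rfl⟩ : ∃ i, j = i + 2 := ⟨j - 2, by omega⟩
        obtain ⟨V₁, rfl⟩ := (pr_bijective hr hrn).2 V
        obtain ⟨T₂, rfl⟩ := (pr_bijective hr hrn).2 V₁
        obtain ⟨Z, hZ, -⟩ := FStep.comm_left (i := i) (by omega) (by omega) (by omega) (by omega)
          (by omega) h ((h2 (by omega) hjn).1 hV)
        exact hex _ hj hjn _ ((h2 (by omega) hjn).2 hZ)
      · have := h.mult (n - 1)
        rw [if_pos rfl, if_neg (by omega)] at this
        omega
      · by_cases han : a ≤ n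
        · have := h.mult (a - 2)
          rw [if_neg (by omega), if_neg (by omega)] at this
          rw [m3 a ha han, m3' a ha han]
          omega
        · rw [mult_of_not_mem _ (by omega), mult_of_not_mem _ (by omega)]

/-- The pairs of tableaux connected by `f̃_i`. -/
def edges (n r s i : ℕ) : Set (SST n r s × SST n r s) := {p | FStep i p.1 p.2}

theorem ncard_edges (hr : 1 ≤ r) (hrn : r < n) (i : ℕ) (hin : i + 1 < n) :
    (edges n r s (i + 1)).ncard = (edges n r s 1).ncard := by
  induction i with
  | zero => rfl
  | succ i ih =>
    rw [← ih (by omega), ← Set.ncard_image_of_injective (edges n r s (i + 1))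
      ((pr_injective hr hrn).prodMap (pr_injective hr hrn))]
    congr 1
    ext ⟨U, V⟩
    obtain ⟨T, rfl⟩ := (pr_bijective hr hrn).2 U
    obtain ⟨T', rfl⟩ := (pr_bijective hr hrn).2 V
    constructor
    · intro h
      exact ⟨(T, T'), (fStep_pr_iff hr hrn (by omega) (by omega)).1 h, rfl⟩
    · rintro ⟨⟨A, B⟩, h, e⟩
      obtain ⟨e1, e2⟩ := Prod.mk.inj e
      have := (fStep_pr_iff hr hrn (i := i + 1) (by omega) (by omega)).2 h
      simp only [e1, e2] at this
      exact this

/-- Since promotion matches the edges of all colours `1, …, n - 1` with each other, the injection of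
the edges of colour `n - 1` into those of colour `1` is a bijection. -/
theorem fStep_pr_pr_iff (hr : 1 ≤ r) (hrn : r < n) {T T' : SST n r s} :
    FStep 1 T.pr.pr T'.pr.pr ↔ FStep (n - 1) T T' := by
  refine ⟨fun h => ?_, FStep.pr_pr hr hrn⟩
  have hinj : Function.Injective fun T : SST n r s => T.pr.pr :=
    (pr_injective hr hrn).comp (pr_injective hr hrn)
  have himg : Prod.map (fun T : SST n r s => T.pr.pr) (fun T : SST n r s => T.pr.pr) ''
      edges n r s (n - 1) = edges n r s 1 := by
    refine Set.eq_of_subset_of_ncard_le ?_ ?_ (Set.toFinite _)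
    · rintro _ ⟨⟨A, B⟩, hAB, rfl⟩
      exact FStep.pr_pr hr hrn hAB
    · rw [Set.ncard_image_of_injective _ (hinj.prodMap hinj)]
      have := ncard_edges (s := s) hr hrn (n - 2) (by omega)
      rw [show n - 2 + 1 = n - 1 by omega] at this
      exact this.ge
  obtain ⟨⟨A, B⟩, hAB, e⟩ : (T.pr.pr, T'.pr.pr) ∈ _ '' edges n r s (n - 1) :=
    himg.symm ▸ (show (T.pr.pr, T'.pr.pr) ∈ edges n r s 1 from h)
  obtain ⟨e1, e2⟩ := Prod.mk.inj e
  rw [← hinj e1, ← hinj e2]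
  exact hAB

theorem fStep_iterate_pr_iff (hr : 1 ≤ r) (hrn : r < n) {i : ℕ} (hi : 1 ≤ i) (k : ℕ)
    (hin : i + k < n) {T T' : SST n r s} :
    FStep (i + k) (pr^[k] T) (pr^[k] T') ↔ FStep i T T' := by
  induction k with
  | zero => rfl
  | succ k ih =>
    rw [Function.iterate_succ_apply', Function.iterate_succ_apply', ← ih (by omega)]
    exact fStep_pr_iff hr hrn (i := i + k) (by omega) (by omega)

theorem fStep_iterate_pr_iff_of_gt (hr : 1 ≤ r) (hrn : r < n) {i k : ℕ} (hin : i < n) (hkn : k < n)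
    (hik : n < i + k) {T T' : SST n r s} :
    FStep (i + k - n) (pr^[k] T) (pr^[k] T') ↔ FStep i T T' := by
  obtain ⟨d, hd⟩ : ∃ d, i + d + 1 = n := ⟨n - 1 - i, by omega⟩
  obtain ⟨c, hc⟩ : ∃ c, k = c + (2 + d) := ⟨k - 2 - d, by omega⟩
  subst hc
  rw [Function.iterate_add_apply pr c, Function.iterate_add_apply pr c,
    Function.iterate_add_apply pr 2 d T, Function.iterate_add_apply pr 2 d T',
    show i + (c + (2 + d)) - n = 1 + c by omega,
    fStep_iterate_pr_iff hr hrn le_rfl c (by omega)]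
  refine (fStep_pr_pr_iff hr hrn).trans ?_
  rw [show n - 1 = i + d by omega]
  exact fStep_iterate_pr_iff hr hrn (by omega) d (by omega)

theorem iterate_pr_mult (hr : 1 ≤ r) (hrn : r < n) (T : SST n r s) {a : ℕ} (ha : 1 ≤ a)
    (han : a ≤ n) (k : ℕ) (hkn : k < n) :
    (pr^[k] T).mult (if a + k ≤ n then a + k else a + k - n) = T.mult a := by
  induction k with
  | zero => simp [han]
  | succ k ih =>
    rw [← ih (by omega), Function.iterate_succ_apply']
    rcases lt_trichotomy (a + k) n with h | h | h
    · rw [if_pos (by omega), if_pos (by omega)]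
      exact pr_mult_succ hr hrn _ (a := a + k) (by omega) h
    · rw [if_neg (by omega), if_pos (by omega), show a + (k + 1) - n = 1 by omega, h]
      exact pr_mult_one hr hrn _
    · rw [if_neg (by omega), if_neg (by omega), show a + (k + 1) - n = a + k - n + 1 by omega]
      exact pr_mult_succ hr hrn _ (a := a + k - n) (by omega) (by omega)

end SST

/-! ### The Lusztig involutions -/

open SST

variable {n r s : ℕ}

theorem longest_mem {k a : ℕ} (hk : k < n) (ha : 1 ≤ a ∧ a ≤ n) :
    1 ≤ longest n k a ∧ longest n k a ≤ n := by
  unfold longest; split_ifs <;> omega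

theorem longest_longest {k a : ℕ} (ha : 1 ≤ a ∧ a ≤ n) : longest n k (longest n k a) = a := by
  unfold longest; split_ifs <;> omega

theorem star_mem {k i : ℕ} (hk : k < n) (hi : 1 ≤ i) (hin : i < n) (hik : i ≠ k) :
    1 ≤ star n k i ∧ star n k i < n ∧ star n k i ≠ k := by
  unfold star; split_ifs <;> omega

theorem star_star {k i : ℕ} (hi : 1 ≤ i) (hin : i < n) :
    star n k (star n k i) = i := by
  unfold star; split_ifs <;> omega

/-- The properties of a Lusztig involution other than that of being an involution, with the crystal
operators expressed through `FStep`. -/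
structure IsTwist (k : ℕ) (η : SST n r s → SST n r s) : Prop where
  wt : ∀ T, ∀ a, 1 ≤ a → a ≤ n → (η T).mult (longest n k a) = T.mult a
  step : ∀ i, 1 ≤ i → i < n → i ≠ k → ∀ T T', FStep i T T' → FStep (star n k i) (η T') (η T)
  exists_right : ∀ i, 1 ≤ i → i < n → i ≠ k → ∀ T U, FStep (star n k i) U (η T) →
    ∃ T', FStep i T T' ∧ η T' = U
  exists_left : ∀ i, 1 ≤ i → i < n → i ≠ k → ∀ T U, FStep (star n k i) (η T) U →
    ∃ T', FStep i T' T ∧ η T' = U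

theorem IsTwist.of_bijective {k : ℕ} {η : SST n r s → SST n r s} (hη : Function.Bijective η)
    (wt : ∀ T, ∀ a, 1 ≤ a → a ≤ n → (η T).mult (longest n k a) = T.mult a)
    (step : ∀ i, 1 ≤ i → i < n → i ≠ k → ∀ T T',
      FStep (star n k i) (η T') (η T) ↔ FStep i T T') : IsTwist k η where
  wt := wt
  step i h1 h2 h3 T T' h := (step i h1 h2 h3 T T').2 h
  exists_right i h1 h2 h3 T U h := by
    obtain ⟨T', rfl⟩ := hη.2 U
    exact ⟨T', (step i h1 h2 h3 T T').1 h, rfl⟩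
  exists_left i h1 h2 h3 T U h := by
    obtain ⟨T', rfl⟩ := hη.2 U
    exact ⟨T', (step i h1 h2 h3 T' T).1 h, rfl⟩

theorem IsLusztigInvolution.isTwist {k : ℕ} (hk : k < n) {η : SST n r s → SST n r s}
    (h : IsLusztigInvolution k η) : IsTwist k η where
  wt := h.wt
  step i h1 h2 h3 T T' hT := by
    obtain ⟨s1, s2, -⟩ := star_mem hk h1 h2 h3
    rw [← f_eq_some_iff s1 s2, ← h.map_e T' i h1 h2 h3, (e_eq_some_iff h1 h2).2 hT]
    rfl
  exists_right i h1 h2 h3 T U hU := by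
    obtain ⟨s1, s2, -⟩ := star_mem hk h1 h2 h3
    rw [← e_eq_some_iff s1 s2, ← h.map_f T i h1 h2 h3, Option.map_eq_some_iff] at hU
    obtain ⟨T', hT, rfl⟩ := hU
    exact ⟨T', (f_eq_some_iff h1 h2).1 hT, rfl⟩
  exists_left i h1 h2 h3 T U hU := by
    obtain ⟨s1, s2, -⟩ := star_mem hk h1 h2 h3
    rw [← f_eq_some_iff s1 s2, ← h.map_e T i h1 h2 h3, Option.map_eq_some_iff] at hU
    obtain ⟨T', hT, rfl⟩ := hU
    exact ⟨T', (e_eq_some_iff h1 h2).1 hT, rfl⟩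

theorem IsTwist.isLusztigInvolution {k : ℕ} (hk : k < n) {η : SST n r s → SST n r s}
    (h : IsTwist k η) (hη : ∀ T, η (η T) = T) : IsLusztigInvolution k η where
  involutive := hη
  wt := h.wt
  map_e T i h1 h2 h3 := by
    obtain ⟨s1, s2, -⟩ := star_mem hk h1 h2 h3
    refine Option.ext fun U => ?_
    rw [f_eq_some_iff s1 s2, Option.map_eq_some_iff]
    constructor
    · rintro ⟨T', hT, rfl⟩
      exact h.step i h1 h2 h3 _ _ ((e_eq_some_iff h1 h2).1 hT)
    · intro hU
      obtain ⟨T', hT, rfl⟩ := h.exists_left i h1 h2 h3 T U hU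
      exact ⟨T', (e_eq_some_iff h1 h2).2 hT, rfl⟩
  map_f T i h1 h2 h3 := by
    obtain ⟨s1, s2, -⟩ := star_mem hk h1 h2 h3
    refine Option.ext fun U => ?_
    rw [e_eq_some_iff s1 s2, Option.map_eq_some_iff]
    constructor
    · rintro ⟨T', hT, rfl⟩
      exact h.step i h1 h2 h3 _ _ ((f_eq_some_iff h1 h2).1 hT)
    · intro hU
      obtain ⟨T', hT, rfl⟩ := h.exists_right i h1 h2 h3 T U hU
      exact ⟨T', (f_eq_some_iff h1 h2).2 hT, rfl⟩

/-- Multiplicity-freeness forces uniqueness. -/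
theorem IsTwist.unique {k : ℕ} (hk : k < n) {η η' : SST n r s → SST n r s} (h : IsTwist k η)
    (h' : IsTwist k η') : η = η' := by
  funext T
  refine eq_of_bisimulation hk.le
    (fun U V => ∃ T η η', IsTwist k η ∧ IsTwist k η' ∧ U = η T ∧ V = η' T) ?_ ?_ ?_ ?_
    ⟨T, η, η', h, h', rfl, rfl⟩
  · rintro U V ⟨T, η, η', h, h', rfl, rfl⟩
    exact ⟨T, η', η, h', h, rfl, rfl⟩
  · rintro U V ⟨T, η, η', h, h', rfl, rfl⟩ a
    by_cases ha : 1 ≤ a ∧ a ≤ n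
    · obtain ⟨l1, l2⟩ := longest_mem hk ha
      have e := h.wt T _ l1 l2
      have e' := h'.wt T _ l1 l2
      rw [longest_longest ha] at e e'
      rw [e, e']
    · rw [mult_of_not_mem _ ha, mult_of_not_mem _ ha]
  · rintro i hi hik U V U' ⟨T, η, η', h, h', rfl, rfl⟩ hU
    obtain ⟨s1, s2, s3⟩ := star_mem hk hi (show i < n by omega) (show i ≠ k by omega)
    have ss := star_star (k := k) hi (show i < n by omega)
    obtain ⟨T', hT, rfl⟩ := h.exists_right _ s1 s2 s3 T U' (by rwa [ss])
    have := h'.step _ s1 s2 s3 T T' hT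
    rw [ss] at this
    exact ⟨η' T', this, T', η, η', h, h', rfl, rfl⟩
  · rintro i hi hik U V U' ⟨T, η, η', h, h', rfl, rfl⟩ hU
    obtain ⟨s1, s2, s3⟩ := star_mem hk (show 1 ≤ i by omega) hik (show i ≠ k by omega)
    have ss := star_star (k := k) (show 1 ≤ i by omega) hik
    obtain ⟨T', hT, rfl⟩ := h.exists_left _ s1 s2 s3 T U' (by rwa [ss])
    have := h'.step _ s1 s2 s3 T' T hT
    rw [ss] at this
    exact ⟨η' T', this, T', η, η', h, h', rfl, rfl⟩

theorem rot_bijective : Function.Bijective (rot : SST n r s → SST n r s) :=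
  Function.Involutive.bijective rot_rot

theorem fStep_rot_iff {i : ℕ} (hi : 1 ≤ i) (hin : i < n) {T T' : SST n r s} :
    FStep (n - i) T'.rot T.rot ↔ FStep i T T' := by
  refine ⟨fun h => ?_, FStep.rot hi hin⟩
  have := h.rot (by omega) (by omega)
  rwa [rot_rot, rot_rot, show n - (n - i) = i by omega] at this

theorem iterate_pr_rot_bijective (hr : 1 ≤ r) (hrn : r < n) (k : ℕ) :
    Function.Bijective fun T : SST n r s => pr^[k] T.rot :=
  ((pr_bijective hr hrn).iterate k).comp rot_bijective

theorem iterate_pr_rot_mult (hr : 1 ≤ r) (hrn : r < n) {k : ℕ} (hk : k < n) (T : SST n r s) {a : ℕ}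
    (ha : 1 ≤ a) (han : a ≤ n) : (pr^[k] T.rot).mult (longest n k a) = T.mult a := by
  have h1 := iterate_pr_mult hr hrn T.rot (a := n + 1 - a) (by omega) (by omega) k hk
  rw [rot_mult, show n + 1 - (n + 1 - a) = a by omega] at h1
  rw [← h1]
  congr 1
  unfold longest
  split_ifs <;> omega

theorem fStep_iterate_pr_rot_iff (hr : 1 ≤ r) (hrn : r < n) {k : ℕ} (hk : k < n) {i : ℕ}
    (hi : 1 ≤ i) (hin : i < n) (hik : i ≠ k) {T T' : SST n r s} :
    FStep (star n k i) (pr^[k] T'.rot) (pr^[k] T.rot) ↔ FStep i T T' := by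
  rw [← fStep_rot_iff hi hin]
  unfold star
  split_ifs with h
  · rw [← fStep_iterate_pr_iff_of_gt hr hrn (show n - i < n by omega) hk (by omega),
      show n - i + k - n = k - i by omega]
  · rw [← fStep_iterate_pr_iff hr hrn (show 1 ≤ n - i by omega) k (by omega),
      show n - i + k = n + k - i by omega]

/-- The Lusztig involution for the nodes other than `k` is the rotation followed by `k` promotions.
It is an involution, because its inverse has the same properties. -/
theorem isLusztigInvolution_iterate_pr_rot (hr : 1 ≤ r) (hrn : r < n) {k : ℕ} (hk : k < n) :
    IsLusztigInvolution k fun T : SST n r s => pr^[k] T.rot := by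
  have hbij := iterate_pr_rot_bijective (s := s) hr hrn k
  set ψ := Equiv.ofBijective _ hbij
  have hψa : ∀ T, ψ T = pr^[k] T.rot := fun T => rfl
  have h1 : IsTwist k ψ := .of_bijective ψ.bijective
    (fun T a ha han => iterate_pr_rot_mult hr hrn hk T ha han)
    (fun i h1 h2 h3 T T' => fStep_iterate_pr_rot_iff hr hrn hk h1 h2 h3)
  have h2 : IsTwist k ψ.symm := by
    refine .of_bijective ψ.symm.bijective (fun T a ha han => ?_) fun i h1 h2 h3 T T' => ?_
    · obtain ⟨l1, l2⟩ := longest_mem hk ⟨ha, han⟩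
      have := iterate_pr_rot_mult hr hrn hk (ψ.symm T) l1 l2
      rw [longest_longest ⟨ha, han⟩, ← hψa, Equiv.apply_symm_apply] at this
      exact this.symm
    · obtain ⟨s1, s2, s3⟩ := star_mem hk h1 h2 h3
      rw [← fStep_iterate_pr_rot_iff hr hrn hk s1 s2 s3, star_star h1 h2, ← hψa, ← hψa,
        Equiv.apply_symm_apply, Equiv.apply_symm_apply]
  have he := h1.unique hk h2
  exact h1.isLusztigInvolution hk fun T => by
    rw [congrFun he (ψ T), Equiv.symm_apply_apply]

theorem existsUnique_isLusztigInvolution (hr : 1 ≤ r) (hrn : r < n) {k : ℕ} (hk : k < n) :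
    ∃! η : SST n r s → SST n r s, IsLusztigInvolution k η :=
  ⟨_, isLusztigInvolution_iterate_pr_rot hr hrn hk, fun _ h =>
    (h.isTwist hk).unique hk ((isLusztigInvolution_iterate_pr_rot hr hrn hk).isTwist hk)⟩

theorem lusztig_eq (hr : 1 ≤ r) (hrn : r < n) {k : ℕ} (hk : k < n) :
    (lusztig k : SST n r s → SST n r s) = fun T => pr^[k] T.rot :=
  (existsUnique_isLusztigInvolution hr hrn hk).unique
    (Classical.epsilon_spec ⟨_, isLusztigInvolution_iterate_pr_rot hr hrn hk⟩)
    (isLusztigInvolution_iterate_pr_rot hr hrn hk)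

theorem iterate_promotion (hr : 1 ≤ r) (hrn : r < n) (k : ℕ) (T : SST n r s) :
    (promotion n r s)^[k] T.fill = (pr^[k] T).fill := by
  induction k with
  | zero => rfl
  | succ k ih =>
    rw [Function.iterate_succ_apply', Function.iterate_succ_apply', ih,
      (pr_spec hr hrn (pr^[k] T)).1]

end KRCrystal

theorem mainTheorem6 (n r s k : ℕ) (hr : 1 ≤ r) (hrn : r < n) (hs : 1 ≤ s)
    (hk : 1 ≤ k) (hkn : k < n) :
    (∃! η : KRCrystal.SST n r s → KRCrystal.SST n r s, KRCrystal.IsLusztigInvolution 0 η) ∧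
    (∃! η : KRCrystal.SST n r s → KRCrystal.SST n r s, KRCrystal.IsLusztigInvolution k η) ∧
    ∀ T : KRCrystal.SST n r s,
      (KRCrystal.promotion n r s)^[k] T.fill =
        (KRCrystal.lusztig k (KRCrystal.lusztig 0 T)).fill := by
  refine ⟨KRCrystal.existsUnique_isLusztigInvolution hr hrn (by omega),
    KRCrystal.existsUnique_isLusztigInvolution hr hrn hkn, fun T => ?_⟩
  rw [KRCrystal.lusztig_eq hr hrn hkn, KRCrystal.lusztig_eq hr hrn (by omega),
    KRCrystal.iterate_promotion hr hrn]
  simp only [Function.iterate_zero, id, KRCrystal.SST.rot_rot]
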